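/- Let $H=(H^1,\dots,H^m)\in C^{1,1}_{\rm loc}(\mathbb R^d;\mathbb R^m)$, that is, $H$ is $C^1$ with locally Lipschitz derivative, and consider $$du=\sum_{i=1}^m H^i(Du)\cdot dB_i \ \text{ in } Q_\infty=\mathbb R^d\times(0,\infty),\qquad u(\cdot,0)=u_0. \tag{1}$$ Here $C_0([0,\infty);\mathbb R^m)$ is the set of continuous paths $B:[0,\infty)\to\mathbb R^m$ with $B(0)=0$; convergence in $C([0,\infty);\mathbb R^m)$ means uniform convergence on $[0,T]$ for every $T>0$; ${\rm BUC}$ means bounded and uniformly continuous, and ${\rm BUC}(\overline Q_\infty)$ is the set of functions on $\overline Q_\infty=\mathbb R^d\times[0,\infty)$ that are bounded and uniformly continuous on $\overline Q_T=\mathbb R^d\times[0,T]$ for every $T>0$, with uniform convergence on every $\overline Q_T$. For $B\in C_0\cap C^1([0,\infty);\mathbb R^m)$, a viscosity solution of (1) is a $u\in{\rm BUC}(\overline Q_\infty)$ with $u(\cdot,0)=u_0$ such that, for every $C^1$ test function $\phi$ on $\mathbb R^d\times\mathbb R$, $\phi_t\le\sum_i H^i(D\phi)\dot B_i$ at each local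 maximum of $u-\phi$ in $Q_\infty$ and $\phi_t\ge\sum_i H^i(D\phi)\dot B_i$ at each local minimum of $u-\phi$ in $Q_\infty$. (i) For every $B\in C_0\cap C^1([0,\infty);\mathbb R^m)$ and $u_0\in{\rm BUC}(\mathbb R^d)$ there is exactly one viscosity solution of (1). (ii) Let $(\zeta^\varepsilon)_{\varepsilon>0},(\xi^\eta)_{\eta>0}$ be families in $C_0\cap C^1([0,\infty);\mathbb R^m)$ and $(u_0^\varepsilon)_{\varepsilon>0},(v_0^\eta)_{\eta>0}$ families in ${\rm BUC}(\mathbb R^d)$ such that, as $\varepsilon,\eta\to0$, $u^\varepsilon_0-v^\eta_0\to0$ uniformly on $\mathbb R^d$, and let $u^\varepsilon,v^\eta$ be the viscosity solutions of (1) with paths and initial data $(\zeta^\varepsilon,u_0^\varepsilon)$ and $(\xi^\eta,v_0^\eta)$. If $\zeta^\varepsilon-\xi^\eta\to0$ in $C([0,\infty);\mathbb R^m)$, then $u^\varepsilon-v^\eta\to0$ uniformly on $\overline Q_T$ for every $T>0$. If $\zeta^\varepsilon-\xi^\eta\to0$ uniformly on $[0,\infty)$, then $u^\varepsilon-v^\eta\to0$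 uniformly on $\overline Q_\infty$. (In particular, with $\xi=\zeta$ and $v_0=u_0$, the solutions form a Cauchy family.) (iii) For every $B\in C_0([0,\infty);\mathbb R^m)$ and $u_0\in{\rm BUC}(\mathbb R^d)$ there is a unique $u\in{\rm BUC}(\overline Q_\infty)$ such that, for all families $(B^\varepsilon)_{\varepsilon>0}$ in $C_0\cap C^1([0,\infty);\mathbb R^m)$ and $(u_0^\varepsilon)_{\varepsilon>0}$ in ${\rm BUC}(\mathbb R^d)$ with $B^\varepsilon\to B$ in $C([0,\infty);\mathbb R^m)$ and $u^\varepsilon_0\to u_0$ uniformly on $\mathbb R^d$ as $\varepsilon\to0$, the viscosity solutions $u^\varepsilon$ of (1) with path $B^\varepsilon$ and initial datum $u^\varepsilon_0$ converge to $u$ uniformly on $\overline Q_T$ for every $T>0$. If moreover $B^\varepsilon\to B$ uniformly on $[0,\infty)$, then $u^\varepsilon\to u$ uniformly on $\overline Q_\infty$. If $B$ is $C^1$, then $u$ is the viscosity solution of (1). -/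

import Mathlib

open Filter Topology Set

/-- `f` is bounded and uniformly continuous on the set `S`. -/
def IsBUCOn {X : Type*} [UniformSpace X] (f : X → ℝ) (S : Set X) : Prop :=
  (∃ C : ℝ, ∀ x ∈ S, |f x| ≤ C) ∧ UniformContinuousOn f S

/-- `u` is bounded and uniformly continuous on `ℝᵈ × [0, T]` for every finite `T`.
Functions on `ℝᵈ × [0, ∞)` are represented by functions on `ℝᵈ × ℝ` whose values at negative
times play no role. -/
def IsBUCSpaceTime {d : ℕ} (u : EuclideanSpace ℝ (Fin d) × ℝ → ℝ) : Prop :=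
  ∀ T : ℝ, 0 < T → IsBUCOn u (univ ×ˢ Icc 0 T)

/-- `H` is of class `C^{1,1}_loc`. -/
def IsC11Loc {d m : ℕ} (H : EuclideanSpace ℝ (Fin d) → EuclideanSpace ℝ (Fin m)) : Prop :=
  ContDiff ℝ 1 H ∧ LocallyLipschitz (fderiv ℝ H)

/-- Continuous paths `[0, ∞) → ℝᵐ` starting at `0`. -/
def IsContPath {m : ℕ} (B : ℝ → EuclideanSpace ℝ (Fin m)) : Prop :=
  ContinuousOn B (Ici 0) ∧ B 0 = 0

/-- Paths `[0, ∞) → ℝᵐ` starting at `0` that are `C¹` up to time `0`. -/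
def IsC1Path {m : ℕ} (B : ℝ → EuclideanSpace ℝ (Fin m)) : Prop :=
  ContDiffOn ℝ 1 B (Ici 0) ∧ B 0 = 0

/-- The right-hand side `∑ᵢ Hⁱ(p) Ḃᵢ(t)` (used at times `t > 0` only). -/
noncomputable def drivenHamiltonian {d m : ℕ}
    (H : EuclideanSpace ℝ (Fin d) → EuclideanSpace ℝ (Fin m))
    (B : ℝ → EuclideanSpace ℝ (Fin m)) (p : EuclideanSpace ℝ (Fin d)) (t : ℝ) : ℝ :=
  ∑ i, H p i * deriv B t i

/-- Viscosity subsolutions of `u_t = ∑ᵢ Hⁱ(Du) Ḃᵢ` in `ℝᵈ × (0, ∞)`. -/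
def IsViscositySubsolution {d m : ℕ}
    (H : EuclideanSpace ℝ (Fin d) → EuclideanSpace ℝ (Fin m))
    (B : ℝ → EuclideanSpace ℝ (Fin m)) (u : EuclideanSpace ℝ (Fin d) × ℝ → ℝ) : Prop :=
  ∀ φ : EuclideanSpace ℝ (Fin d) × ℝ → ℝ, ContDiff ℝ 1 φ →
    ∀ (x : EuclideanSpace ℝ (Fin d)) (t : ℝ), 0 < t →
      IsLocalMax (fun q => u q - φ q) (x, t) →
        deriv (fun s => φ (x, s)) t ≤ drivenHamiltonian H B (gradient (fun y => φ (y, t)) x) t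

/-- Viscosity supersolutions of `u_t = ∑ᵢ Hⁱ(Du) Ḃᵢ` in `ℝᵈ × (0, ∞)`. -/
def IsViscositySupersolution {d m : ℕ}
    (H : EuclideanSpace ℝ (Fin d) → EuclideanSpace ℝ (Fin m))
    (B : ℝ → EuclideanSpace ℝ (Fin m)) (u : EuclideanSpace ℝ (Fin d) × ℝ → ℝ) : Prop :=
  ∀ φ : EuclideanSpace ℝ (Fin d) × ℝ → ℝ, ContDiff ℝ 1 φ →
    ∀ (x : EuclideanSpace ℝ (Fin d)) (t : ℝ), 0 < t →
      IsLocalMin (fun q => u q - φ q) (x, t) →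
        drivenHamiltonian H B (gradient (fun y => φ (y, t)) x) t ≤ deriv (fun s => φ (x, s)) t

/-- `u` is a BUC viscosity solution of the initial value problem
`u_t = ∑ᵢ Hⁱ(Du) Ḃᵢ` in `ℝᵈ × (0, ∞)`, `u(·, 0) = u₀`. -/
structure IsViscositySolution {d m : ℕ}
    (H : EuclideanSpace ℝ (Fin d) → EuclideanSpace ℝ (Fin m))
    (B : ℝ → EuclideanSpace ℝ (Fin m)) (u₀ : EuclideanSpace ℝ (Fin d) → ℝ)
    (u : EuclideanSpace ℝ (Fin d) × ℝ → ℝ) : Prop where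
  buc : IsBUCSpaceTime u
  initial : ∀ x, u (x, 0) = u₀ x
  sub : IsViscositySubsolution H B u
  super : IsViscositySupersolution H B u

/-- A family of viscosity solutions `uε` (`ε > 0`) driven by `C¹` paths `ζε`, with BUC initial
data `uε₀`. -/
def IsSolutionFamily {d m : ℕ}
    (H : EuclideanSpace ℝ (Fin d) → EuclideanSpace ℝ (Fin m))
    (ζ : ℝ → ℝ → EuclideanSpace ℝ (Fin m)) (u₀ : ℝ → EuclideanSpace ℝ (Fin d) → ℝ)
    (u : ℝ → EuclideanSpace ℝ (Fin d) × ℝ → ℝ) : Prop :=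
  ∀ ε : ℝ, 0 < ε →
    IsC1Path (ζ ε) ∧ IsBUCOn (u₀ ε) univ ∧ IsViscositySolution H (ζ ε) (u₀ ε) (u ε)

/-- `u` is the limit, uniformly on `ℝᵈ × [0, T]` for every `T`, of every family of viscosity
solutions whose `C¹` paths approximate `B` in `C([0, ∞))` (that is, uniformly on each `[0, T]`)
and whose initial data approximate `u₀` uniformly. -/
def IsLimitOfSolutions {d m : ℕ}
    (H : EuclideanSpace ℝ (Fin d) → EuclideanSpace ℝ (Fin m))
    (B : ℝ → EuclideanSpace ℝ (Fin m)) (u₀ : EuclideanSpace ℝ (Fin d) → ℝ)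
    (u : EuclideanSpace ℝ (Fin d) × ℝ → ℝ) : Prop :=
  ∀ (ζ : ℝ → ℝ → EuclideanSpace ℝ (Fin m)) (w₀ : ℝ → EuclideanSpace ℝ (Fin d) → ℝ)
    (w : ℝ → EuclideanSpace ℝ (Fin d) × ℝ → ℝ),
    IsSolutionFamily H ζ w₀ w →
    (∀ T : ℝ, 0 < T → TendstoUniformlyOn ζ B (𝓝[>] 0) (Icc 0 T)) →
    TendstoUniformly w₀ u₀ (𝓝[>] 0) →
    ∀ T : ℝ, 0 < T → TendstoUniformlyOn w u (𝓝[>] 0) (univ ×ˢ Icc 0 T)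

/-! The core is a stability estimate that sees the paths only through their uniform distance.
Suppose `W (z, s)`, with `s` a multidimensional time, is a C¹ solution of D_s W = H(D_z W) for small
`s`. Let `u` be driven by `ζ` and `v` by `ξ`, put σ = ζ - ξ, and double the variables with W(x - y,
σ(t)) as the test function. Its time derivative is ⟨H(D_z W), σ'⟩, which cancels the two driving
terms exactly, so no bound on the derivatives of the paths enters the estimate
(`sub_le_add_of_multitime_solution`).

Such a `W` is the maximum over ‖p‖ ≤ L of ⟨p, z⟩ + ⟨H p, s⟩ - a‖p‖² (`exists_envelope`). The C^{1,1}
bound on `H` makes this expression strictly concave in `p` for ‖s‖ < a / M; the maximizer p* is then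
unique and the envelope theorem gives D_z W = p* and D_s W = H p*. Since W(z, 0) ≥ L‖z‖ - aL² and
W(0, s) ≤ C‖s‖, a small `a` followed by a small radius for σ yields `exists_stability_radius`.
Taking ζ = ξ gives comparison. General BUC data obey an approximate Lipschitz bound, so the estimate
also gives the asymptotic equality of families (`exists_uniform_stability_radius`).

Existence for C¹ paths starts with Lipschitz data and a globally Lipschitz Hamiltonian. The monotone
Lax–Friedrichs scheme preserves the Lipschitz constant in space, and its limit along an ultrafilter
is a viscosity solution. Because the gradients stay in a ball, a merely locally Lipschitz `H` may be
modified outside that ball. Infimal convolution of the data, comparison and stability under uniform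
limits then cover all BUC data.

For a continuous path, moving averages supply C¹ approximations. The stability estimate makes the
corresponding solutions Cauchy and forces every other approximating family to the same limit. -/

/-! ### Maxima of families of affine functions -/

section Danskin

variable {P Y : Type*} [NormedAddCommGroup Y] [NormedSpace ℝ Y]
  {K : Set P} {l : P → Y →L[ℝ] ℝ} {c : P → ℝ} {sel : Y → P} {y : Y}

/-- A selection of maximizers is continuous (after applying the continuous map `l`) where the
maximizer is unique. -/
theorem continuousAt_comp_argmax [TopologicalSpace P] (hK : IsCompact K) (hl : ContinuousOn l K)
    (hc : ContinuousOn c K) (hsel : ∀ z, sel z ∈ K)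
    (hmax : ∀ z, ∀ p ∈ K, l p z - c p ≤ l (sel z) z - c (sel z))
    (huniq : ∀ p ∈ K, l p y - c p = l (sel y) y - c (sel y) → p = sel y) :
    ContinuousAt (fun z => l (sel z)) y := by
  rw [ContinuousAt, tendsto_iff_ultrafilter]
  intro g hg
  -- By compactness the selected maximizers converge along the ultrafilter to some `p`; the limit is
  -- again a maximizer at `y`, hence equal to `sel y`.
  obtain ⟨p, hpK, hp⟩ := hK.ultrafilter_le_nhds (g.map sel) (by
    rw [le_principal_iff]; exact Filter.mem_map.2 (Filter.univ_mem' hsel))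
  have hpt : Tendsto sel g (𝓝[K] p) :=
    tendsto_nhdsWithin_iff.2 ⟨hp, Filter.univ_mem' hsel⟩
  have hlp : Tendsto (fun z => l (sel z)) g (𝓝 (l p)) := (hl p hpK).tendsto.comp hpt
  have hcp : Tendsto (fun z => c (sel z)) g (𝓝 (c p)) := (hc p hpK).tendsto.comp hpt
  have hid : Tendsto (fun z : Y => z) g (𝓝 y) := hg
  have h1 : Tendsto (fun z => l (sel z) z - c (sel z)) g (𝓝 (l p y - c p)) :=
    ((isBoundedBilinearMap_apply.continuous.tendsto (l p, y)).comp (hlp.prodMk_nhds hid)).sub hcp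
  have h2 : Tendsto (fun z => l (sel y) z - c (sel y)) g (𝓝 (l (sel y) y - c (sel y))) :=
    (((l (sel y)).continuous.tendsto y).comp hid).sub tendsto_const_nhds
  have h3 : l (sel y) y - c (sel y) ≤ l p y - c p :=
    le_of_tendsto_of_tendsto' h2 h1 fun z => hmax z _ (hsel y)
  have := huniq p hpK (le_antisymm (hmax y p hpK) h3)
  exact this ▸ hlp

/-- The envelope theorem: the maximum of a compact family of affine functions is differentiable
where the maximizer is unique. -/
theorem hasFDerivAt_argmax (hsel : ∀ z, sel z ∈ K)
    (hmax : ∀ z, ∀ p ∈ K, l p z - c p ≤ l (sel z) z - c (sel z))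
    (hcont : ContinuousAt (fun z => l (sel z)) y) :
    HasFDerivAt (fun z => l (sel z) z - c (sel z)) (l (sel y)) y := by
  rw [hasFDerivAt_iff_isLittleO, Asymptotics.isLittleO_iff]
  intro ε hε
  have h := Metric.continuousAt_iff'.1 hcont ε hε
  filter_upwards [h] with z hz
  -- Optimality at `z` makes the first-order remainder nonnegative; optimality at `y` bounds it by
  -- `(l (sel z) - l (sel y)) (z - y)`, which is small by continuity of the selection.
  have h1 := hmax z _ (hsel y)
  have h2 := hmax y _ (hsel z)
  have h3 : (l (sel z) - l (sel y)) (z - y) ≤ ε * ‖z - y‖ := by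
    refine (le_abs_self _).trans ?_
    rw [dist_eq_norm] at hz
    exact ((l (sel z) - l (sel y)).le_opNorm _).trans (by gcongr)
  simp only [sub_apply, map_sub] at h3 ⊢
  rw [Real.norm_eq_abs, abs_le]
  have : 0 ≤ ε * ‖z - y‖ := by positivity
  constructor <;> linarith

theorem contDiffAt_argmax {U : Set Y} (hU : IsOpen U) (hsel : ∀ z, sel z ∈ K)
    (hmax : ∀ z, ∀ p ∈ K, l p z - c p ≤ l (sel z) z - c (sel z))
    (hcont : ∀ z ∈ U, ContinuousAt (fun z => l (sel z)) z) (hy : y ∈ U) :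
    ContDiffAt ℝ 1 (fun z => l (sel z) z - c (sel z)) y := by
  refine contDiffAt_one_iff.2 ⟨fun z => l (sel z), U, hU.mem_nhds hy,
    fun z hz => (hcont z hz).continuousWithinAt, fun z hz => ?_⟩
  exact hasFDerivAt_argmax hsel hmax (hcont z hz)

end Danskin

/-! ### Smooth solutions of the equation with multidimensional time -/

/-- A `C^{1,1}_loc` function has quadratically bounded midpoint second differences on balls. -/
theorem IsC11Loc.exists_midpoint_le {d m : ℕ}
    {H : EuclideanSpace ℝ (Fin d) → EuclideanSpace ℝ (Fin m)} (hH : IsC11Loc H) (L : ℝ) :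
    ∃ M : ℝ, 0 < M ∧ ∀ p q, ‖p‖ ≤ L → ‖q‖ ≤ L →
      ‖H (p + q) + H (p - q) - (2 : ℝ) • H p‖ ≤ M * ‖q‖ ^ 2 := by
  -- The radius is `2 * L` because the segment from `p` to `p + q` may leave the ball of radius `L`.
  obtain ⟨k, hk⟩ := (hH.2.locallyLipschitzOn
    (s := Metric.closedBall (0 : EuclideanSpace ℝ (Fin d)) (2 * L))).exists_lipschitzOnWith_of_compact
      (isCompact_closedBall 0 (2 * L))
  have key : ∀ p q, ‖p‖ ≤ L → ‖q‖ ≤ L → ‖H (p + q) - H p - fderiv ℝ H p q‖ ≤ k * ‖q‖ ^ 2 := by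
    intro p q hp hq
    have h := (convex_segment p (p + q)).norm_image_sub_le_of_norm_hasFDerivWithin_le'
      (f := H) (f' := fderiv ℝ H) (φ := fderiv ℝ H p) (C := k * ‖q‖) (x := p) (y := p + q)
      (fun x _ => ((hH.1.differentiable (by norm_num)) x).hasFDerivAt.hasFDerivWithinAt)
      (fun x hx => by
        have hx' : ‖x - p‖ ≤ ‖q‖ := by
          have := norm_sub_le_of_mem_segment hx
          simpa using this
        have hxL : ‖x‖ ≤ 2 * L := by
          calc ‖x‖ = ‖p + (x - p)‖ := by congr 1; abel
            _ ≤ ‖p‖ + ‖x - p‖ := norm_add_le _ _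
            _ ≤ 2 * L := by linarith
        have hpL : ‖p‖ ≤ 2 * L := by linarith [norm_nonneg p]
        have := hk.dist_le_mul x (by simpa using hxL) p (by simpa using hpL)
        rw [dist_eq_norm, dist_eq_norm] at this
        exact this.trans (by gcongr))
      (left_mem_segment ℝ _ _) (right_mem_segment ℝ _ _)
    rw [add_sub_cancel_left] at h
    calc _ ≤ _ := h
      _ = _ := by ring
  -- Adding the Taylor bounds for `q` and `-q` cancels the linear terms and gives `2 * k`; the extra
  -- 1 only ensures positivity.
  refine ⟨2 * k + 1, by positivity, fun p q hp hq => ?_⟩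
  have h1 := key p q hp hq
  have h2 := key p (-q) hp (by simpa using hq)
  rw [norm_neg] at h2
  have : H (p + q) + H (p - q) - (2 : ℝ) • H p
      = (H (p + q) - H p - fderiv ℝ H p q) + (H (p + -q) - H p - fderiv ℝ H p (-q)) := by
    rw [map_neg, two_smul, sub_eq_add_neg p q]; abel
  rw [this]
  refine (norm_add_le _ _).trans ?_
  nlinarith [sq_nonneg ‖q‖]

/-- The functions `(z, s) ↦ max_{|p| ≤ L} ⟪p, z⟫ + ⟪H p, s⟫ - a |p|²` are, for small `s`, smooth
solutions of the Hamilton–Jacobi equation with multidimensional time `s`. -/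
theorem exists_envelope {E F : Type*} [NormedAddCommGroup E] [InnerProductSpace ℝ E]
    [ProperSpace E] [NormedAddCommGroup F] [InnerProductSpace ℝ F] {H : E → F}
    (hcH : Continuous H) {L M a : ℝ} (hL : 0 ≤ L) (ha : 0 < a) (hM : 0 < M)
    (hmid : ∀ p q, ‖p‖ ≤ L → ‖q‖ ≤ L → ‖H (p + q) + H (p - q) - (2 : ℝ) • H p‖ ≤ M * ‖q‖ ^ 2) :
    ∃ (r C : ℝ) (W : E × F → ℝ) (g : E × F → E),
      0 < r ∧ 0 ≤ C ∧ (∀ y, ‖g y‖ ≤ L) ∧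
      (∀ y, ‖y.2‖ < r → ContDiffAt ℝ 1 W y ∧
        HasFDerivAt W ((innerSL ℝ (g y)).comp (ContinuousLinearMap.fst ℝ E F)
          + (innerSL ℝ (H (g y))).comp (ContinuousLinearMap.snd ℝ E F)) y) ∧
      (∀ z, L * ‖z‖ - a * L ^ 2 ≤ W (z, 0)) ∧ (∀ z, 0 ≤ W (z, 0)) ∧ W (0, 0) ≤ 0 ∧
      (∀ z s s', W (z, s) ≤ W (z, s') + C * ‖s - s'‖) := by
  set K : Set E := Metric.closedBall 0 L with hKdef
  have hK : IsCompact K := isCompact_closedBall 0 L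
  have hmemK : ∀ p : E, p ∈ K ↔ ‖p‖ ≤ L := fun p => by simp [hKdef]
  obtain ⟨C, hC⟩ := hK.exists_bound_of_continuousOn hcH.continuousOn
  let l : E → (E × F →L[ℝ] ℝ) := fun p => (innerSL ℝ p).comp (ContinuousLinearMap.fst ℝ E F)
          + (innerSL ℝ (H p)).comp (ContinuousLinearMap.snd ℝ E F)
  have hlapp : ∀ p y, l p y = inner ℝ p y.1 + inner ℝ (H p) y.2 := fun p y => by simp [l]
  have hl : Continuous l := by
    unfold l
    fun_prop
  have hc : Continuous (fun p : E => a * ‖p‖ ^ 2) := by fun_prop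
  have hex : ∀ y : E × F, ∃ p ∈ K, ∀ q ∈ K, l q y - a * ‖q‖ ^ 2 ≤ l p y - a * ‖p‖ ^ 2 := by
    intro y
    obtain ⟨p, hp, hpm⟩ := hK.exists_isMaxOn (f := fun p => l p y - a * ‖p‖ ^ 2)
      ⟨0, by simpa [hKdef] using hL⟩ (by fun_prop)
    exact ⟨p, hp, fun q hq => hpm hq⟩
  choose g hgK hgmax using hex
  -- Compare two maximizers with their midpoint `o`, where `e` is half their difference. By the
  -- parallelogram law the quadratic term gains a multiple of `a * ‖e‖ ^ 2` at `o`, while the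
  -- curvature of `H` costs at most a multiple of `M * ‖e‖ ^ 2 * ‖y.2‖`; for small `y.2` the gain
  -- wins unless `e = 0`.
  have huniq : ∀ y : E × F, ‖y.2‖ < a / M → ∀ p ∈ K,
      l p y - a * ‖p‖ ^ 2 = l (g y) y - a * ‖g y‖ ^ 2 → p = g y := by
    intro y hy p hp hpe
    set b := g y with hb
    have hbK : b ∈ K := hgK y
    set o : E := (2⁻¹ : ℝ) • (p + b) with ho
    set e : E := (2⁻¹ : ℝ) • (p - b) with he
    have hpo : p = o + e := by rw [ho, he, ← smul_add]; simp [← two_smul ℝ p]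
    have hbo : b = o - e := by rw [ho, he, ← smul_sub]; simp [← two_smul ℝ b]
    rw [hmemK] at hp hbK
    have hoL : ‖o‖ ≤ L := by
      rw [ho, norm_smul]
      have := norm_add_le p b
      norm_num; linarith
    have heL : ‖e‖ ≤ L := by
      rw [he, norm_smul]
      have := norm_sub_le p b
      norm_num; linarith
    have h1 := hgmax y o ((hmemK o).2 hoL)
    have h2 := hmid o e hoL heL
    rw [← hpo, ← hbo] at h2
    have h3 : |inner ℝ (H p + H b - (2 : ℝ) • H o) y.2| ≤ M * ‖e‖ ^ 2 * ‖y.2‖ :=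
      (abs_real_inner_le_norm _ _).trans (by gcongr)
    have h4 : ‖p‖ ^ 2 + ‖b‖ ^ 2 = 2 * (‖o‖ ^ 2 + ‖e‖ ^ 2) := by
      rw [hpo, hbo]
      have := parallelogram_law_with_norm ℝ o e
      nlinarith
    have h5 : inner ℝ p y.1 + inner ℝ b y.1 = 2 * inner ℝ o y.1 := by
      rw [hpo, hbo, inner_add_left, inner_sub_left]; ring
    have h6 : inner ℝ (H p + H b - (2 : ℝ) • H o) y.2
        = inner ℝ (H p) y.2 + inner ℝ (H b) y.2 - 2 * inner ℝ (H o) y.2 := by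
      rw [inner_sub_left, inner_add_left, real_inner_smul_left]
    rw [h6] at h3
    rw [hlapp, hlapp] at hpe h1
    have h7 := (abs_le.1 h3).2
    have h4a : a * ‖p‖ ^ 2 + a * ‖b‖ ^ 2 = 2 * (a * ‖o‖ ^ 2 + a * ‖e‖ ^ 2) := by
      rw [← mul_add, h4]; ring
    have h4b : 0 ≤ a * ‖e‖ ^ 2 := by positivity
    have h8 : M * ‖y.2‖ < a := by rwa [lt_div_iff₀ hM, mul_comm] at hy
    rw [← hb] at h1
    have h9 : ‖e‖ ^ 2 * (a - M * ‖y.2‖) ≤ 0 := by nlinarith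
    have h10 : ‖e‖ ^ 2 = 0 := by
      by_contra hne
      have : 0 < ‖e‖ ^ 2 := lt_of_le_of_ne (sq_nonneg _) (Ne.symm hne)
      nlinarith
    have h11 : e = 0 := norm_eq_zero.1 (pow_eq_zero_iff two_ne_zero |>.1 h10)
    rw [hpo, hbo, h11]; simp
  have hcont : ∀ y ∈ {y : E × F | ‖y.2‖ < a / M}, ContinuousAt (fun z => l (g z)) y := fun y hy =>
    continuousAt_comp_argmax (c := fun p => a * ‖p‖ ^ 2) hK hl.continuousOn hc.continuousOn hgK
      hgmax (huniq y hy)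
  have hopen : IsOpen {y : E × F | ‖y.2‖ < a / M} := isOpen_lt (by fun_prop) continuous_const
  refine ⟨a / M, C, fun y => l (g y) y - a * ‖g y‖ ^ 2, g, by positivity,
    (norm_nonneg _).trans (hC 0 (by simpa [hKdef] using hL)), fun y => (hmemK _).1 (hgK y),
    fun y hy => ⟨contDiffAt_argmax (c := fun p => a * ‖p‖ ^ 2) hopen hgK hgmax hcont hy,
      hasFDerivAt_argmax (c := fun p => a * ‖p‖ ^ 2) hgK hgmax (hcont y hy)⟩, ?_, ?_, ?_, ?_⟩
  · intro z
    rcases eq_or_ne z 0 with rfl | hz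
    · have := hgmax (0, 0) 0 ((hmemK 0).2 (by simpa using hL))
      simp only [hlapp] at this ⊢
      simp at this ⊢
      nlinarith [sq_nonneg L]
    · have hz' : 0 < ‖z‖ := norm_pos_iff.2 hz
      have hn : ‖(L / ‖z‖) • z‖ = L := by
        rw [norm_smul, Real.norm_of_nonneg (by positivity)]; field_simp
      have := hgmax (z, 0) ((L / ‖z‖) • z) ((hmemK _).2 hn.le)
      refine le_trans (le_of_eq ?_) this
      rw [hn, hlapp]
      simp only [inner_zero_right, add_zero, real_inner_smul_left, real_inner_self_eq_norm_sq]
      field_simp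
  · intro z
    have := hgmax (z, 0) 0 ((hmemK 0).2 (by simpa using hL))
    simpa [hlapp] using this
  · simp only [hlapp]
    simp
    positivity
  · intro z s s'
    have h1 := hgmax (z, s') (g (z, s)) (hgK _)
    have h2 : inner ℝ (H (g (z, s))) (s - s') ≤ C * ‖s - s'‖ :=
      (real_inner_le_norm _ _).trans (by gcongr; exact hC _ (hgK _))
    rw [inner_sub_right] at h2
    simp only [hlapp] at h1 ⊢
    linarith

/-! ### Elementary properties of viscosity sub- and supersolutions -/

section Viscosity

variable {d m : ℕ}

local notation "𝔼" => EuclideanSpace ℝ (Fin d)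
local notation "𝔽" => EuclideanSpace ℝ (Fin m)

theorem drivenHamiltonian_eq_inner (H : 𝔼 → 𝔽) (B : ℝ → 𝔽) (p : 𝔼) (t : ℝ) :
    drivenHamiltonian H B p t = inner ℝ (H p) (deriv B t) := by
  simp [drivenHamiltonian, PiLp.inner_apply, mul_comm]

/-- The linear form on space-time with spatial gradient `p` and time derivative `τ`. -/
noncomputable def spaceTimeForm (p : 𝔼) (τ : ℝ) : 𝔼 × ℝ →L[ℝ] ℝ :=
  (innerSL ℝ p).comp (ContinuousLinearMap.fst ℝ 𝔼 ℝ) + τ • ContinuousLinearMap.snd ℝ 𝔼 ℝ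

@[simp] theorem spaceTimeForm_apply (p : 𝔼) (τ : ℝ) (q : 𝔼 × ℝ) :
    spaceTimeForm p τ q = inner ℝ p q.1 + τ * q.2 := by
  simp [spaceTimeForm]

theorem HasFDerivAt.deriv_spaceTime {φ : 𝔼 × ℝ → ℝ} {p : 𝔼} {τ : ℝ} {x : 𝔼} {t : ℝ}
    (h : HasFDerivAt φ (spaceTimeForm p τ) (x, t)) : deriv (fun s => φ (x, s)) t = τ := by
  have := h.comp_hasDerivAt t ((hasDerivAt_const t x).prodMk (hasDerivAt_id t))
  simpa [Function.comp_def] using this.deriv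

theorem HasFDerivAt.neg_spaceTimeForm {φ : 𝔼 × ℝ → ℝ} {p : 𝔼} {τ : ℝ} {q : 𝔼 × ℝ}
    (h : HasFDerivAt φ (spaceTimeForm p τ) q) :
    HasFDerivAt (fun z => -φ z) (spaceTimeForm (-p) (-τ)) q := by
  refine h.fun_neg.congr_fderiv (ContinuousLinearMap.ext fun v => ?_)
  simp only [neg_apply, spaceTimeForm_apply, inner_neg_left]
  ring

theorem HasFDerivAt.gradient_spaceTime {φ : 𝔼 × ℝ → ℝ} {p : 𝔼} {τ : ℝ} {x : 𝔼} {t : ℝ}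
    (h : HasFDerivAt φ (spaceTimeForm p τ) (x, t)) : gradient (fun y => φ (y, t)) x = p := by
  have h1 : HasFDerivAt (fun y => φ (y, t))
      ((spaceTimeForm p τ).comp ((ContinuousLinearMap.id ℝ 𝔼).prod 0)) x :=
    h.comp x ((hasFDerivAt_id x).prodMk (hasFDerivAt_const t x))
  have h2 : (spaceTimeForm p τ).comp ((ContinuousLinearMap.id ℝ 𝔼).prod 0)
      = InnerProductSpace.toDual ℝ 𝔼 p := by
    ext v; simp
  rw [h2] at h1
  exact (hasGradientAt_iff_hasFDerivAt.2 h1).gradient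

/-- Continuity of the two components lets viscosity inequalities at moving contact points pass to
the limit. -/
theorem ContDiff.exists_continuous_spaceTimeForm {φ : 𝔼 × ℝ → ℝ} (hφ : ContDiff ℝ 1 φ) :
    ∃ (p : 𝔼 × ℝ → 𝔼) (τ : 𝔼 × ℝ → ℝ), Continuous p ∧ Continuous τ ∧
      ∀ q, HasFDerivAt φ (spaceTimeForm (p q) (τ q)) q := by
  have hc := hφ.continuous_fderiv (by norm_num)
  refine ⟨fun q => (InnerProductSpace.toDual ℝ 𝔼).symm
    ((fderiv ℝ φ q).comp (ContinuousLinearMap.inl ℝ 𝔼 ℝ)), fun q => fderiv ℝ φ q (0, 1), ?_, ?_,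
    fun q => ?_⟩
  · exact (InnerProductSpace.toDual ℝ 𝔼).symm.continuous.comp (by fun_prop)
  · fun_prop
  refine ((hφ.differentiable (by norm_num)) q).hasFDerivAt.congr_fderiv
    (ContinuousLinearMap.ext fun v => ?_)
  have hv : v = (v.1, 0) + v.2 • ((0, 1) : 𝔼 × ℝ) := by ext <;> simp
  conv_lhs => rw [hv]
  rw [map_add, map_smul, spaceTimeForm_apply, ← InnerProductSpace.toDual_apply_apply (𝕜 := ℝ)]
  simp [mul_comm]

theorem ContDiff.exists_hasFDerivAt_spaceTimeForm {φ : 𝔼 × ℝ → ℝ} (hφ : ContDiff ℝ 1 φ)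
    (q : 𝔼 × ℝ) : ∃ p τ, HasFDerivAt φ (spaceTimeForm p τ) q :=
  let ⟨p, τ, _, _, h⟩ := hφ.exists_continuous_spaceTimeForm
  ⟨p q, τ q, h q⟩

/-- Local test functions may be used instead of global ones. -/
theorem IsViscositySubsolution.le_of_isLocalMax {H : 𝔼 → 𝔽} {B : ℝ → 𝔽} {u : 𝔼 × ℝ → ℝ}
    (hu : IsViscositySubsolution H B u) {φ : 𝔼 × ℝ → ℝ} {x : 𝔼} {t : ℝ} (ht : 0 < t)
    (hφ : ContDiffAt ℝ 1 φ (x, t)) (hmax : IsLocalMax (fun q => u q - φ q) (x, t)) {p : 𝔼} {τ : ℝ}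
    (hd : HasFDerivAt φ (spaceTimeForm p τ) (x, t)) : τ ≤ inner ℝ (H p) (deriv B t) := by
  obtain ⟨ε, hε, hball⟩ := Metric.eventually_nhds_iff_ball.1 (hφ.eventually (by simp))
  let χ : ContDiffBump ((x, t) : 𝔼 × ℝ) := ⟨ε / 4, ε / 2, by positivity, by linarith⟩
  have hψ : ContDiff ℝ 1 (fun q => χ q * φ q) := by
    rw [contDiff_iff_contDiffAt]
    intro q
    by_cases hq : q ∈ Metric.ball ((x, t) : 𝔼 × ℝ) ε
    · exact χ.contDiff.contDiffAt.mul (hball q hq)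
    · have hopen : (Metric.closedBall ((x, t) : 𝔼 × ℝ) (ε / 2))ᶜ ∈ 𝓝 q := by
        refine Metric.isClosed_closedBall.isOpen_compl.mem_nhds ?_
        simp only [mem_compl_iff, Metric.mem_closedBall, Metric.mem_ball, not_lt, not_le] at hq ⊢
        linarith
      have hev : (fun q => χ q * φ q) =ᶠ[𝓝 q] fun _ => 0 := by
        filter_upwards [hopen] with z hz
        have : χ z = 0 := χ.zero_of_le_dist (by
          simp only [mem_compl_iff, Metric.mem_closedBall, not_le] at hz
          exact hz.le)
        simp [this]
      exact contDiffAt_const.congr_of_eventuallyEq hev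
  have hev : (fun q => χ q * φ q) =ᶠ[𝓝 (x, t)] φ := by
    filter_upwards [χ.eventuallyEq_one] with z hz
    simp [hz]
  have hmax' : IsLocalMax (fun q => u q - χ q * φ q) (x, t) := by
    filter_upwards [hmax, hev] with z hz hz'
    rw [hz', hev.eq_of_nhds]
    exact hz
  have h := hu _ hψ x t ht hmax'
  have hd' : HasFDerivAt (fun q => χ q * φ q) (spaceTimeForm p τ) (x, t) :=
    hd.congr_of_eventuallyEq hev
  rwa [hd'.deriv_spaceTime, hd'.gradient_spaceTime, drivenHamiltonian_eq_inner] at h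

/-- Sign changes exchange sub- and supersolutions. -/
theorem IsViscositySupersolution.neg {H : 𝔼 → 𝔽} {B : ℝ → 𝔽} {u : 𝔼 × ℝ → ℝ}
    (hu : IsViscositySupersolution H B u) :
    IsViscositySubsolution (fun p => -H (-p)) B (fun q => -u q) := by
  intro φ hφ x t ht hmax
  have hmin : IsLocalMin (fun q => u q - (-φ q)) (x, t) := by
    filter_upwards [hmax] with z hz
    linarith
  have h := hu _ hφ.neg x t ht hmin
  obtain ⟨p, τ, hd⟩ := hφ.exists_hasFDerivAt_spaceTimeForm (x, t)
  have hd' : HasFDerivAt (fun q => -φ q) (spaceTimeForm (-p) (-τ)) (x, t) :=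
    hd.neg_spaceTimeForm
  rw [hd'.deriv_spaceTime, hd'.gradient_spaceTime, drivenHamiltonian_eq_inner] at h
  rw [hd.deriv_spaceTime, hd.gradient_spaceTime, drivenHamiltonian_eq_inner, inner_neg_left]
  linarith

theorem IsViscositySupersolution.of_neg {H : 𝔼 → 𝔽} {B : ℝ → 𝔽} {u : 𝔼 × ℝ → ℝ}
    (hu : IsViscositySubsolution (fun p => -H (-p)) B (fun q => -u q)) :
    IsViscositySupersolution H B u := by
  intro φ hφ x t ht hmin
  have hmax : IsLocalMax (fun q => -u q - (-φ q)) (x, t) := by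
    filter_upwards [hmin] with z hz
    linarith
  have h := hu _ hφ.neg x t ht hmax
  obtain ⟨p, τ, hd⟩ := hφ.exists_hasFDerivAt_spaceTimeForm (x, t)
  have hd' : HasFDerivAt (fun q => -φ q) (spaceTimeForm (-p) (-τ)) (x, t) :=
    hd.neg_spaceTimeForm
  rw [hd'.deriv_spaceTime, hd'.gradient_spaceTime, drivenHamiltonian_eq_inner, inner_neg_left,
    neg_neg] at h
  rw [hd.deriv_spaceTime, hd.gradient_spaceTime, drivenHamiltonian_eq_inner]
  linarith

theorem IsViscositySupersolution.le_of_isLocalMin {H : 𝔼 → 𝔽} {B : ℝ → 𝔽} {u : 𝔼 × ℝ → ℝ}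
    (hu : IsViscositySupersolution H B u) {φ : 𝔼 × ℝ → ℝ} {x : 𝔼} {t : ℝ} (ht : 0 < t)
    (hφ : ContDiffAt ℝ 1 φ (x, t)) (hmin : IsLocalMin (fun q => u q - φ q) (x, t)) {p : 𝔼} {τ : ℝ}
    (hd : HasFDerivAt φ (spaceTimeForm p τ) (x, t)) : inner ℝ (H p) (deriv B t) ≤ τ := by
  have hd' : HasFDerivAt (fun q => -φ q) (spaceTimeForm (-p) (-τ)) (x, t) :=
    hd.neg_spaceTimeForm
  have hmax : IsLocalMax (fun q => -u q - (-φ q)) (x, t) := by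
    filter_upwards [hmin] with z hz
    linarith
  have h := hu.neg.le_of_isLocalMax ht hφ.neg hmax hd'
  rw [inner_neg_left, neg_neg] at h
  linarith

/-- The derivative of a `C¹` path extends continuously to the real line. -/
theorem IsC1Path.exists_deriv {B : ℝ → 𝔽} (hB : IsC1Path B) :
    ∃ b : ℝ → 𝔽, Continuous b ∧ ∀ t, 0 < t → HasDerivAt B (b t) t := by
  -- The one-sided derivative at 0 is frozen for negative times, where `B` is arbitrary and `deriv
  -- B` carries no information.
  refine ⟨fun t => derivWithin B (Ici 0) (max t 0), ?_, fun t ht => ?_⟩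
  · exact (hB.1.continuousOn_derivWithin (uniqueDiffOn_Ici 0) le_rfl).comp_continuous
      (by fun_prop) (fun t => mem_Ici.2 (le_max_right _ _))
  · simp only [max_eq_left ht.le]
    have h := ((hB.1.differentiableOn (by norm_num)) t ht.le).hasDerivWithinAt
    exact h.hasDerivAt (Ici_mem_nhds ht)

theorem IsC1Path.contDiffAt {B : ℝ → 𝔽} (hB : IsC1Path B) {t : ℝ} (ht : 0 < t) :
    ContDiffAt ℝ 1 B t :=
  hB.1.contDiffAt (Ici_mem_nhds ht)

end Viscosity

/-! ### Doubling of variables -/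

section Doubling

variable {d m : ℕ}

local notation "𝔼" => EuclideanSpace ℝ (Fin d)
local notation "𝔽" => EuclideanSpace ℝ (Fin m)

theorem HasFDerivAt.add_spaceTimeForm {φ ψ : 𝔼 × ℝ → ℝ} {p p' : 𝔼} {τ τ' : ℝ} {q : 𝔼 × ℝ}
    (h : HasFDerivAt φ (spaceTimeForm p τ) q) (h' : HasFDerivAt ψ (spaceTimeForm p' τ') q) :
    HasFDerivAt (fun z => φ z + ψ z) (spaceTimeForm (p + p') (τ + τ')) q := by
  refine (h.fun_add h').congr_fderiv (ContinuousLinearMap.ext fun v => ?_)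
  simp only [add_apply, spaceTimeForm_apply, inner_add_left]
  ring

theorem HasDerivAt.hasFDerivAt_spaceTimeForm {f : ℝ → ℝ} {τ t : ℝ} (h : HasDerivAt f τ t) (x : 𝔼) :
    HasFDerivAt (fun q : 𝔼 × ℝ => f q.2) (spaceTimeForm 0 τ) (x, t) := by
  have h' : HasDerivAt f τ (Prod.snd (x, t)) := h
  refine (h'.hasFDerivAt.comp (x, t) hasFDerivAt_snd).congr_fderiv
    (ContinuousLinearMap.ext fun v => ?_)
  simp [mul_comm]

theorem hasFDerivAt_mul_norm_sq (β : ℝ) (x : 𝔼) (t : ℝ) :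
    HasFDerivAt (fun q : 𝔼 × ℝ => β * ‖q.1‖ ^ 2) (spaceTimeForm ((2 * β) • x) 0) (x, t) := by
  have h : HasFDerivAt (fun q : 𝔼 × ℝ => q.1) (ContinuousLinearMap.fst ℝ 𝔼 ℝ) (x, t) :=
    hasFDerivAt_fst
  refine (h.norm_sq.const_mul β).congr_fderiv (ContinuousLinearMap.ext fun v => ?_)
  simp [real_inner_smul_left]
  ring

theorem IsBUCSpaceTime.exists_time_modulus {u : 𝔼 × ℝ → ℝ} (hu : IsBUCSpaceTime u) {T : ℝ}
    (hT : 0 < T) {ε : ℝ} (hε : 0 < ε) :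
    ∃ η > 0, ∀ x, ∀ t ∈ Icc 0 T, ∀ s ∈ Icc 0 T, |t - s| ≤ η → |u (x, t) - u (x, s)| ≤ ε := by
  obtain ⟨η, hη, h⟩ := Metric.uniformContinuousOn_iff_le.1 (hu T hT).2 ε hε
  refine ⟨η, hη, fun x t ht s hs hts => ?_⟩
  refine h (x, t) ⟨mem_univ _, ht⟩ (x, s) ⟨mem_univ _, hs⟩ ?_
  simpa [Prod.dist_eq, Real.dist_eq, hη.le] using hts

theorem exists_modulus_on_ball {H : 𝔼 → 𝔽} (hH : Continuous H) (L : ℝ) {ε : ℝ} (hε : 0 < ε) :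
    ∃ η > 0, ∀ p q, ‖p‖ ≤ L → ‖q‖ ≤ η → ‖H (p + q) - H p‖ ≤ ε := by
  have huc := (isCompact_closedBall (0 : 𝔼) (L + 1)).uniformContinuousOn_of_continuous
    hH.continuousOn
  obtain ⟨η, hη, h⟩ := Metric.uniformContinuousOn_iff_le.1 huc ε hε
  refine ⟨min η 1, by positivity, fun p q hp hq => ?_⟩
  rw [← dist_eq_norm]
  have h1 := hq.trans (min_le_left _ _)
  have h2 := hq.trans (min_le_right _ _)
  refine h _ ?_ _ ?_ (by simpa [dist_eq_norm] using h1)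
  · simpa using (norm_add_le p q).trans (by linarith)
  · simp; linarith

theorem exists_modulus_on_Icc {b : ℝ → 𝔽} (hb : Continuous b) (T : ℝ) {ε : ℝ} (hε : 0 < ε) :
    ∃ η > 0, ∀ t ∈ Icc 0 T, ∀ s ∈ Icc 0 T, |t - s| ≤ η → ‖b t - b s‖ ≤ ε := by
  have huc := (isCompact_Icc (a := (0 : ℝ)) (b := T)).uniformContinuousOn_of_continuous
    hb.continuousOn
  obtain ⟨η, hη, h⟩ := Metric.uniformContinuousOn_iff_le.1 huc ε hε
  exact ⟨η, hη, fun t ht s hs hts => by simpa [dist_eq_norm] using h t ht s hs (by simpa [Real.dist_eq] using hts)⟩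

theorem IsBUCSpaceTime.continuousOn {u : 𝔼 × ℝ → ℝ} (hu : IsBUCSpaceTime u) :
    ContinuousOn u (univ ×ˢ Ici 0) := by
  rintro ⟨x, t⟩ ⟨-, ht⟩
  have ht' : 0 ≤ t := ht
  refine ((hu (t + 1) (by linarith)).2.continuousOn (x, t)
    ⟨mem_univ _, ht, by linarith⟩).mono_of_mem_nhdsWithin ?_
  have : univ ×ˢ Iio (t + 1) ∈ 𝓝 (x, t) :=
    (isOpen_univ.prod isOpen_Iio).mem_nhds ⟨mem_univ _, by simp⟩
  filter_upwards [mem_nhdsWithin_of_mem_nhds this, self_mem_nhdsWithin] with q h1 h2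
  exact ⟨mem_univ _, h2.2, le_of_lt h1.2⟩

set_option maxHeartbeats 1000000 in
/-- Comparison of a subsolution and a supersolution driven by different paths by means of a smooth
solution `W` of the Hamilton–Jacobi equation with multidimensional time. -/
theorem sub_le_add_of_multitime_solution {H : 𝔼 → 𝔽} (hH : Continuous H) {L r C : ℝ} {W : 𝔼 × 𝔽 → ℝ}
    {g : 𝔼 × 𝔽 → 𝔼} (hC : 0 ≤ C) (hgL : ∀ y, ‖g y‖ ≤ L)
    (hW : ∀ y, ‖y.2‖ < r → ContDiffAt ℝ 1 W y ∧
        HasFDerivAt W ((innerSL ℝ (g y)).comp (ContinuousLinearMap.fst ℝ 𝔼 𝔽)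
          + (innerSL ℝ (H (g y))).comp (ContinuousLinearMap.snd ℝ 𝔼 𝔽)) y)
    (hW0 : ∀ z, 0 ≤ W (z, 0)) (hWC : ∀ z s s', W (z, s) ≤ W (z, s') + C * ‖s - s'‖)
    {ζ ξ : ℝ → 𝔽} {u v : 𝔼 × ℝ → ℝ} {A T : ℝ} (hζ : IsC1Path ζ) (hξ : IsC1Path ξ)
    (hu : IsBUCSpaceTime u) (hv : IsBUCSpaceTime v) (hus : IsViscositySubsolution H ζ u)
    (hvs : IsViscositySupersolution H ξ v)
    (hinit : ∀ x y, u (x, 0) - v (y, 0) ≤ A + W (x - y, 0))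
    (hr : ∀ t ∈ Icc 0 T, ‖ζ t - ξ t‖ < r) {x₀ : 𝔼} {t₀ : ℝ} (ht₀ : 0 ≤ t₀) (htT : t₀ < T) :
    u (x₀, t₀) - v (x₀, t₀) ≤ A + W (0, ζ t₀ - ξ t₀) := by
  by_contra! hcon
  have hT : 0 < T := by linarith
  obtain ⟨bζ, hbζ, hdζ⟩ := hζ.exists_deriv
  obtain ⟨bξ, hbξ, hdξ⟩ := hξ.exists_deriv
  set σ : ℝ → 𝔽 := fun t => ζ t - ξ t with hσ
  have hσ0 : σ 0 = 0 := by simp [hσ, hζ.2, hξ.2]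
  -- the excess at the reference point
  obtain ⟨δ, hδ, hδe⟩ : ∃ δ > 0, A + W (0, σ t₀) + 4 * δ ≤ u (x₀, t₀) - v (x₀, t₀) :=
    ⟨(u (x₀, t₀) - v (x₀, t₀) - (A + W (0, ζ t₀ - ξ t₀))) / 4, by linarith, by
      linarith⟩
  -- bounds
  obtain ⟨Cu, hCu⟩ := (hu T hT).1
  obtain ⟨Cv, hCv⟩ := (hv T hT).1
  obtain ⟨Mζ, hMζ⟩ := (isCompact_Icc (a := (0 : ℝ)) (b := T)).exists_bound_of_continuousOn
    hbζ.continuousOn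
  obtain ⟨Mξ, hMξ⟩ := (isCompact_Icc (a := (0 : ℝ)) (b := T)).exists_bound_of_continuousOn
    hbξ.continuousOn
  obtain ⟨MH, hMH⟩ := (isCompact_closedBall (0 : 𝔼) L).exists_bound_of_continuousOn hH.continuousOn
  have h0T : (0 : ℝ) ∈ Icc 0 T := ⟨le_rfl, hT.le⟩
  have hMζ0 := (norm_nonneg _).trans (hMζ 0 h0T)
  have hMξ0 := (norm_nonneg _).trans (hMξ 0 h0T)
  have hMHg : ∀ y, ‖H (g y)‖ ≤ MH := fun y => hMH _ (by simpa using hgL y)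
  have hMH0 := (norm_nonneg _).trans (hMHg 0)
  have hcσ : ContinuousOn σ (Icc 0 T) :=
    (hζ.1.continuousOn.sub hξ.1.continuousOn).mono Icc_subset_Ici_self
  -- `N` bounds the sum of all penalties at the maximum point (`hpen`); the parameters below are
  -- tuned to it.
  set N : ℝ := max (Cu + Cv + C * r - A - 2 * δ) 1 with hN
  have hN1 : 1 ≤ N := le_max_right _ _
  -- the increasing penalization of time
  set κ : ℝ := δ / 2
  have hκ : 0 < κ := by positivity
  -- This makes `k T > N`, which excludes maxima at the terminal time, whereas `k t₀ = κ` costs only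
  -- `2 * κ = δ` at the reference point.
  obtain ⟨c, hc0, hcN⟩ : ∃ c > 0, N < κ * Real.exp (c * (T - t₀)) := by
    refine ⟨N / (κ * (T - t₀)), by have := sub_pos.2 htT; positivity, ?_⟩
    have h1 : N / (κ * (T - t₀)) * (T - t₀) = N / κ := by
      have := (sub_pos.2 htT).ne'
      field_simp
    rw [h1]
    have := Real.add_one_le_exp (N / κ)
    calc N = κ * (N / κ) := by field_simp
      _ < κ * (N / κ + 1) := by gcongr; linarith
      _ ≤ _ := by gcongr
  set k : ℝ → ℝ := fun t => κ * Real.exp (c * (t - t₀)) with hk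
  have hkd : ∀ t, HasDerivAt k (c * k t) t := by
    intro t
    have := ((((hasDerivAt_id t).sub_const t₀).const_mul c).exp).const_mul κ
    refine this.congr_deriv ?_
    simp only [hk, id]
    ring
  have hkc : ContDiff ℝ 1 k := by unfold k; fun_prop
  have hkpos : ∀ t, 0 < k t := fun t => by positivity
  -- `γ` is the derivative of `k` at 0, a lower bound for it at later times. The two viscosity
  -- inequalities gain `2 * γ`, and the tolerances below keep the total error at most `γ`.
  set γ : ℝ := c * (κ * Real.exp (c * (0 - t₀)))
  have hγ : 0 < γ := by positivity
  have hγk : ∀ t, 0 ≤ t → γ ≤ c * k t := fun t ht => by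
    simp only [γ, hk]; gcongr
  -- moduli of continuity
  obtain ⟨η₁, hη₁, hmu⟩ := hu.exists_time_modulus hT (half_pos hδ)
  obtain ⟨η₂, hη₂, hmv⟩ := hv.exists_time_modulus hT (half_pos hδ)
  obtain ⟨η₃, hη₃, hmH⟩ := exists_modulus_on_ball hH L (ε := γ / (2 * (Mζ + Mξ + 1)))
    (by positivity)
  obtain ⟨η₄, hη₄, hmb⟩ := exists_modulus_on_Icc hbξ T (ε := γ / (2 * (MH + 1))) (by positivity)
  obtain ⟨η₅, hη₅, hmσ⟩ : ∃ η > 0, ∀ t ∈ Icc 0 T, t ≤ η → C * ‖σ t - σ 0‖ ≤ δ := by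
    have huc := (isCompact_Icc (a := (0 : ℝ)) (b := T)).uniformContinuousOn_of_continuous hcσ
    obtain ⟨η, hη, h⟩ := Metric.uniformContinuousOn_iff_le.1 huc (δ / (C + 1)) (by positivity)
    refine ⟨η, hη, fun t ht hts => ?_⟩
    have := h t ht 0 h0T (by simpa [abs_of_nonneg ht.1] using hts)
    rw [dist_eq_norm, le_div_iff₀ (by positivity)] at this
    nlinarith [norm_nonneg (σ t - σ 0)]
  -- The first condition makes the spatial penalty cheap at `x₀`; the second makes its gradient `(2
  -- * β) • w` at most `η₃` wherever the penalty is at most `N`.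
  obtain ⟨β, hβ, hβ1, hβ2⟩ : ∃ β > 0, β * (2 * ‖x₀‖ ^ 2) ≤ δ ∧ 4 * β * N ≤ η₃ ^ 2 := by
    refine ⟨min (δ / (2 * ‖x₀‖ ^ 2 + 1)) (η₃ ^ 2 / (4 * N)), by positivity, ?_, ?_⟩
    · have := min_le_left (δ / (2 * ‖x₀‖ ^ 2 + 1)) (η₃ ^ 2 / (4 * N))
      calc _ ≤ δ / (2 * ‖x₀‖ ^ 2 + 1) * (2 * ‖x₀‖ ^ 2 + 1) := by gcongr; linarith
        _ = δ := by field_simp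
    · have := min_le_right (δ / (2 * ‖x₀‖ ^ 2 + 1)) (η₃ ^ 2 / (4 * N))
      calc _ ≤ 4 * (η₃ ^ 2 / (4 * N)) * N := by gcongr
        _ = η₃ ^ 2 := by field_simp
  obtain ⟨η, hη, hηa⟩ : ∃ η > 0, η ≤ η₁ ∧ η ≤ η₂ ∧ η ≤ η₄ ∧ η ≤ η₅ :=
    ⟨min (min η₁ η₂) (min η₄ η₅), by positivity, by simp, by simp, by simp, by simp⟩
  obtain ⟨h1, h2, h4, h5⟩ := hηa
  obtain ⟨θ, hθ, hθN⟩ : ∃ θ > 0, 2 * θ * N ≤ η ^ 2 :=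
    ⟨η ^ 2 / (2 * N), by positivity, by field_simp; rfl⟩
  -- Since `(N / β + 1) ^ 2 > N / β`, points with penalty at most `N` lie strictly inside this ball,
  -- so the constrained maximum is interior in space.
  set R : ℝ := max (‖x₀‖) (N / β + 1)
  -- maximization
  set S : Set (𝔼 × 𝔼 × ℝ × ℝ) :=
    Metric.closedBall 0 R ×ˢ Metric.closedBall 0 R ×ˢ Icc 0 T ×ˢ Icc 0 T
  have hScomp : IsCompact S := (isCompact_closedBall 0 R).prod
    ((isCompact_closedBall 0 R).prod (isCompact_Icc.prod isCompact_Icc))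
  set Φ : 𝔼 × 𝔼 × ℝ × ℝ → ℝ := fun q =>
    u (q.1, q.2.2.1) - v (q.2.1, q.2.2.2) - W (q.1 - q.2.1, σ q.2.2.1)
      - (q.2.2.1 - q.2.2.2) ^ 2 / (2 * θ) - k q.2.2.1 - k q.2.2.2
      - β * ‖q.1‖ ^ 2 - β * ‖q.2.1‖ ^ 2 with hΦ
  have hWcont : ∀ y : 𝔼 × 𝔽, ‖y.2‖ < r → ContinuousAt W y := fun y hy =>
    (hW y hy).2.continuousAt
  have hΦc : ContinuousOn Φ S := by
    have c1 : ContinuousOn (fun q : 𝔼 × 𝔼 × ℝ × ℝ => u (q.1, q.2.2.1)) S :=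
      hu.continuousOn.comp (by fun_prop) fun q hq => ⟨mem_univ _, hq.2.2.1.1⟩
    have c2 : ContinuousOn (fun q : 𝔼 × 𝔼 × ℝ × ℝ => v (q.2.1, q.2.2.2)) S :=
      hv.continuousOn.comp (by fun_prop) fun q hq => ⟨mem_univ _, hq.2.2.2.1⟩
    have c3 : ContinuousOn (fun q : 𝔼 × 𝔼 × ℝ × ℝ => σ q.2.2.1) S :=
      hcσ.comp (by fun_prop) fun q hq => hq.2.2.1
    have c4 : ContinuousOn (fun q : 𝔼 × 𝔼 × ℝ × ℝ => W (q.1 - q.2.1, σ q.2.2.1)) S := by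
      intro q hq
      have : ContinuousWithinAt (fun q : 𝔼 × 𝔼 × ℝ × ℝ => (q.1 - q.2.1, σ q.2.2.1)) S q :=
        ContinuousWithinAt.prodMk (by fun_prop) (c3 q hq)
      exact ContinuousAt.comp_continuousWithinAt (hWcont (q.1 - q.2.1, σ q.2.2.1)
        (hr _ hq.2.2.1)) this
    have c5 := hkc.continuous
    unfold Φ
    refine (((((c1.sub c2).sub c4).sub ?_).sub ?_).sub ?_).sub ?_ |>.sub ?_ <;>
      fun_prop
  have href : (x₀, x₀, t₀, t₀) ∈ S := by
    refine ⟨?_, ?_, ⟨ht₀, htT.le⟩, ⟨ht₀, htT.le⟩⟩ <;> simp [R]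
  obtain ⟨⟨x, y, t, s⟩, ⟨hxS, hyS, htS, hsS⟩, hmax⟩ := hScomp.exists_isMaxOn ⟨_, href⟩ hΦc
  simp only at hxS hyS htS hsS
  -- Of the excess `4 * δ` at the reference point, `δ` is spent on the time penalty and at most `δ`
  -- on the spatial one.
  have hge : A + 2 * δ ≤ Φ (x, y, t, s) := by
    refine le_trans ?_ (hmax href)
    simp only [hΦ, sub_self, mul_zero, Real.exp_zero, hk]
    simp only [κ]
    have : (0 : ℝ) ^ 2 / (2 * θ) = 0 := by simp
    rw [this]
    linarith
  have hσr : ∀ t ∈ Icc 0 T, C * ‖σ t‖ ≤ C * r := fun t ht => by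
    have := (hr t ht).le
    gcongr
  have hWlow : ∀ z, ∀ t ∈ Icc 0 T, -(C * r) ≤ W (z, σ t) := fun z t ht => by
    have := hWC z 0 (σ t)
    have := hW0 z
    have := hσr t ht
    rw [zero_sub, norm_neg] at *
    linarith
  -- a priori bounds at the maximum
  have hpen : (t - s) ^ 2 / (2 * θ) + k t + k s + β * ‖x‖ ^ 2 + β * ‖y‖ ^ 2 ≤ N := by
    refine le_trans ?_ (le_max_left _ _)
    have e1 := (abs_le.1 (hCu (x, t) ⟨mem_univ _, htS⟩)).2
    have e2 := (abs_le.1 (hCv (y, s) ⟨mem_univ _, hsS⟩)).1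
    have e3 := hWlow (x - y) t htS
    simp only [hΦ] at hge
    linarith
  have hq1 : 0 ≤ (t - s) ^ 2 / (2 * θ) := by positivity
  have hq2 : 0 ≤ β * ‖x‖ ^ 2 := by positivity
  have hq3 : 0 ≤ β * ‖y‖ ^ 2 := by positivity
  have hkt := hkpos t
  have hks := hkpos s
  have hts : |t - s| ≤ η := by
    have : (t - s) ^ 2 / (2 * θ) ≤ N := by linarith
    rw [div_le_iff₀ (by positivity)] at this
    exact abs_le_of_sq_le_sq (by linarith) hη.le
  have hbx : ∀ w : 𝔼, β * ‖w‖ ^ 2 ≤ N → ‖(2 * β) • w‖ ≤ η₃ := fun w hw => by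
    rw [norm_smul, Real.norm_of_nonneg (by positivity)]
    refine le_of_sq_le_sq ?_ hη₃.le
    calc (2 * β * ‖w‖) ^ 2 = 4 * β * (β * ‖w‖ ^ 2) := by ring
      _ ≤ 4 * β * N := by gcongr
      _ ≤ _ := hβ2
  have hR : ∀ w : 𝔼, β * ‖w‖ ^ 2 ≤ N → ‖w‖ < R := fun w hw => by
    by_contra! hw'
    have h1 : N / β + 1 ≤ ‖w‖ := (le_max_right _ _).trans hw'
    have h3 : 0 < N / β := by positivity
    have h4 : N / β < ‖w‖ ^ 2 := by nlinarith only [h1, h3]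
    have : N < β * ‖w‖ ^ 2 := by rwa [div_lt_iff₀' hβ] at h4
    linarith
  have htT' : t < T := lt_of_le_of_ne htS.2 fun h => by
    rw [h] at hpen hkt
    have : N < k T := hcN
    rw [h] at hq1
    linarith
  have hsT' : s < T := lt_of_le_of_ne hsS.2 fun h => by
    rw [h] at hpen hks
    have : N < k T := hcN
    rw [h] at hq1
    linarith
  -- The initial inequality requires both times to be zero. If one vanishes, moving the other to 0
  -- costs at most `δ / 2`, plus `δ` for `W` when `s = 0`; both are below the excess `2 * δ`.
  have ht0 : 0 < t := by
    refine lt_of_le_of_ne htS.1 fun h => ?_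
    subst h
    have e1 := hinit x y
    have e2 := (abs_le.1 (hmv y 0 htS s hsS (hts.trans h2))).2
    simp only [hΦ, hσ0] at hge
    linarith
  have hs0 : 0 < s := by
    refine lt_of_le_of_ne hsS.1 fun h => ?_
    subst h
    have e1 := hinit x y
    have e2 := (abs_le.1 (hmu x t htS 0 hsS (hts.trans h1))).2
    have e3 := hmσ t htS (by rw [sub_zero, abs_of_pos ht0] at hts; exact hts.trans h5)
    have e4 := hWC (x - y) 0 (σ t)
    rw [hσ0, sub_zero] at e3
    rw [zero_sub, norm_neg] at e4
    simp only [hΦ] at hge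
    linarith
  set P : 𝔼 := g (x - y, σ t) with hP
  have hdσ : HasDerivAt σ (bζ t - bξ t) t := (hdζ t ht0).sub (hdξ t ht0)
  obtain ⟨hWc, hWd⟩ := hW (x - y, σ t) (hr t htS)
  -- the two viscosity inequalities
  have hsub : inner ℝ (H P) (bζ t - bξ t) + ((t - s) / θ + c * k t)
      ≤ inner ℝ (H (P + (2 * β) • x)) (bζ t) := by
    let φ : 𝔼 × ℝ → ℝ := fun q => W (q.1 - y, σ q.2) + ((q.2 - s) ^ 2 / (2 * θ) + k q.2)
      + β * ‖q.1‖ ^ 2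
    -- This is the cancellation: the multi-time equation turns the time derivative of `W` along `σ`
    -- into `⟨H P, bζ t - bξ t⟩`, matching the driving terms of `u` and `v` at the common gradient
    -- `P`.
    have d1 : HasFDerivAt (fun q : 𝔼 × ℝ => W (q.1 - y, σ q.2))
        (spaceTimeForm P (inner ℝ (H P) (bζ t - bξ t))) (x, t) := by
      have e1 : HasFDerivAt (fun q : 𝔼 × ℝ => q.1 - y) (ContinuousLinearMap.fst ℝ 𝔼 ℝ) (x, t) :=
        hasFDerivAt_fst.sub_const y
      have hdσ' : HasDerivAt σ (bζ t - bξ t) (Prod.snd (x, t)) := hdσ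
      have e2 := hdσ'.hasFDerivAt.comp (x, t)
        (hasFDerivAt_snd (𝕜 := ℝ) (E := 𝔼) (F := ℝ) (p := (x, t)))
      refine (HasFDerivAt.comp (g := W) (x, t) hWd (e1.prodMk e2)).congr_fderiv
        (ContinuousLinearMap.ext fun w => ?_)
      simp [← hP]
      ring
    have d2 : HasDerivAt (fun t' : ℝ => (t' - s) ^ 2 / (2 * θ) + k t')
        ((t - s) / θ + c * k t) t := by
      have := ((((hasDerivAt_id t).sub_const s).pow 2).div_const (2 * θ)).add (hkd t)
      refine this.congr_deriv ?_
      simp only [id]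
      field_simp
      ring
    have hd := (d1.add_spaceTimeForm (d2.hasFDerivAt_spaceTimeForm x)).add_spaceTimeForm
      (hasFDerivAt_mul_norm_sq β x t)
    have hcd : ContDiffAt ℝ 1 φ (x, t) := by
      have e1 : ContDiffAt ℝ 1 (fun q : 𝔼 × ℝ => (q.1 - y, σ q.2)) (x, t) := by
        have : ContDiffAt ℝ 1 σ (Prod.snd (x, t)) :=
          (hζ.contDiffAt ht0).sub (hξ.contDiffAt ht0)
        exact ContDiffAt.prodMk (by fun_prop) (this.comp (x, t) contDiffAt_snd)
      have e2 : ContDiffAt ℝ 1 (fun q : 𝔼 × ℝ => W (q.1 - y, σ q.2)) (x, t) :=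
        ContDiffAt.comp (g := W) (x, t) hWc e1
      have e3 : ContDiffAt ℝ 1 (fun q : 𝔼 × ℝ => (q.2 - s) ^ 2 / (2 * θ) + k q.2) (x, t) := by
        refine ContDiffAt.add (by fun_prop) ?_
        exact hkc.contDiffAt.comp (x, t) contDiffAt_snd
      have e4 : ContDiffAt ℝ 1 (fun q : 𝔼 × ℝ => β * ‖q.1‖ ^ 2) (x, t) := by
        have := contDiff_norm_sq ℝ (E := 𝔼) (n := 1)
        exact contDiffAt_const.mul (this.contDiffAt.comp (x, t) contDiffAt_fst)
      exact (e2.add e3).add e4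
    have hlm : IsLocalMax (fun q => u q - φ q) (x, t) := by
      have hopen : Metric.ball (0 : 𝔼) R ×ˢ Ioo 0 T ∈ 𝓝 (x, t) :=
        (Metric.isOpen_ball.prod isOpen_Ioo).mem_nhds
          ⟨by simpa using hR x (by linarith), ht0, htT'⟩
      filter_upwards [hopen] with q hq
      have := hmax (a := (q.1, y, q.2, s))
        ⟨Metric.ball_subset_closedBall hq.1, hyS, Ioo_subset_Icc_self hq.2, hsS⟩
      simp only [mem_ofPred_eq, hΦ] at this
      simp only [φ]
      linarith
    have := hus.le_of_isLocalMax ht0 hcd hlm hd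
    rw [(hdζ t ht0).deriv] at this
    simpa using this
  have hsup : inner ℝ (H (P + -((2 * β) • y))) (bξ s) ≤ (t - s) / θ - c * k s := by
    let φ : 𝔼 × ℝ → ℝ := fun q => -(W (x - q.1, σ t) + ((t - q.2) ^ 2 / (2 * θ) + k q.2)
      + β * ‖q.1‖ ^ 2)
    have d1 : HasFDerivAt (fun q : 𝔼 × ℝ => W (x - q.1, σ t)) (spaceTimeForm (-P) 0) (y, s) := by
      have e1 : HasFDerivAt (fun q : 𝔼 × ℝ => x - q.1) (-ContinuousLinearMap.fst ℝ 𝔼 ℝ) (y, s) :=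
        hasFDerivAt_fst.const_sub x
      refine (HasFDerivAt.comp (g := W) (y, s) hWd
        (e1.prodMk (hasFDerivAt_const (σ t) (y, s)))).congr_fderiv
        (ContinuousLinearMap.ext fun w => ?_)
      simp [← hP]
    have d2 : HasDerivAt (fun t' : ℝ => (t - t') ^ 2 / (2 * θ) + k t')
        (-((t - s) / θ) + c * k s) s := by
      have := ((((hasDerivAt_id s).const_sub t).pow 2).div_const (2 * θ)).add (hkd s)
      refine this.congr_deriv ?_
      simp only [id]
      field_simp
      ring
    have hd := ((d1.add_spaceTimeForm (d2.hasFDerivAt_spaceTimeForm y)).add_spaceTimeForm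
      (hasFDerivAt_mul_norm_sq β y s)).neg_spaceTimeForm
    have hcd : ContDiffAt ℝ 1 φ (y, s) := by
      have e2 : ContDiffAt ℝ 1 (fun q : 𝔼 × ℝ => W (x - q.1, σ t)) (y, s) :=
        ContDiffAt.comp (g := W) (y, s) hWc (by fun_prop)
      have e3 : ContDiffAt ℝ 1 (fun q : 𝔼 × ℝ => (t - q.2) ^ 2 / (2 * θ) + k q.2) (y, s) := by
        refine ContDiffAt.add (by fun_prop) ?_
        exact hkc.contDiffAt.comp (y, s) contDiffAt_snd
      have e4 : ContDiffAt ℝ 1 (fun q : 𝔼 × ℝ => β * ‖q.1‖ ^ 2) (y, s) := by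
        have := contDiff_norm_sq ℝ (E := 𝔼) (n := 1)
        exact contDiffAt_const.mul (this.contDiffAt.comp (y, s) contDiffAt_fst)
      exact ((e2.add e3).add e4).neg
    have hlm : IsLocalMin (fun q => v q - φ q) (y, s) := by
      have hopen : Metric.ball (0 : 𝔼) R ×ˢ Ioo 0 T ∈ 𝓝 (y, s) :=
        (Metric.isOpen_ball.prod isOpen_Ioo).mem_nhds
          ⟨by simpa using hR y (by linarith), hs0, hsT'⟩
      filter_upwards [hopen] with q hq
      have := hmax (a := (x, q.1, t, q.2))
        ⟨hxS, Metric.ball_subset_closedBall hq.1, htS, Ioo_subset_Icc_self hq.2⟩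
      simp only [mem_ofPred_eq, hΦ] at this
      simp only [φ]
      linarith
    have := hvs.le_of_isLocalMin hs0 hcd hlm hd
    rw [(hdξ s hs0).deriv] at this
    simpa [sub_eq_add_neg, add_comm] using this
  -- contradiction
  have f1 : |inner ℝ (H (P + (2 * β) • x) - H P) (bζ t)| ≤ γ / (2 * (Mζ + Mξ + 1)) * Mζ :=
    (abs_real_inner_le_norm _ _).trans (mul_le_mul
      (hmH P _ (hgL _) (hbx x (by linarith))) (hMζ t htS) (norm_nonneg _) (by positivity))
  have f2 : |inner ℝ (H (P + -((2 * β) • y)) - H P) (bξ s)| ≤ γ / (2 * (Mζ + Mξ + 1)) * Mξ :=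
    (abs_real_inner_le_norm _ _).trans (mul_le_mul
      (hmH P _ (hgL _) (by rw [norm_neg]; exact hbx y (by linarith))) (hMξ s hsS)
      (norm_nonneg _) (by positivity))
  have f3 : |inner ℝ (H P) (bξ t - bξ s)| ≤ MH * (γ / (2 * (MH + 1))) :=
    (abs_real_inner_le_norm _ _).trans (mul_le_mul (hMHg _) (hmb t htS s hsS (hts.trans h4))
      (norm_nonneg _) (by positivity))
  have f4 : γ / (2 * (Mζ + Mξ + 1)) * Mζ + γ / (2 * (Mζ + Mξ + 1)) * Mξ ≤ γ / 2 := by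
    rw [← mul_add]
    calc _ ≤ γ / (2 * (Mζ + Mξ + 1)) * (Mζ + Mξ + 1) :=
          mul_le_mul_of_nonneg_left (by linarith) (by positivity)
      _ = γ / 2 := by field_simp
  have f5 : MH * (γ / (2 * (MH + 1))) ≤ γ / 2 := by
    calc _ ≤ (MH + 1) * (γ / (2 * (MH + 1))) := by gcongr; linarith
      _ = γ / 2 := by field_simp
  rw [inner_sub_left] at f1 f2
  rw [inner_sub_right] at f3 hsub
  have g1 := (abs_le.1 f1).2
  have g2 := (abs_le.1 f2).1
  have g3 := (abs_le.1 f3).2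
  have g4 := hγk t ht0.le
  have g5 := hγk s hs0.le
  linarith

/-- The main stability estimate: the influence of the driving path on the solution is controlled by
the uniform norm of the path only. -/
theorem IsC11Loc.exists_stability_radius {H : 𝔼 → 𝔽} (hH : IsC11Loc H) {L δ : ℝ} (hL : 0 ≤ L)
    (hδ : 0 < δ) :
    ∃ r > 0, ∀ {ζ ξ : ℝ → 𝔽} {u v : 𝔼 × ℝ → ℝ} {A T : ℝ}, IsC1Path ζ → IsC1Path ξ →
      IsBUCSpaceTime u → IsBUCSpaceTime v → IsViscositySubsolution H ζ u →
      IsViscositySupersolution H ξ v →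
      (∀ x y, u (x, 0) - v (y, 0) ≤ A + L * ‖x - y‖) →
      (∀ t ∈ Icc 0 T, ‖ζ t - ξ t‖ ≤ r) →
      ∀ x t, 0 ≤ t → t < T → u (x, t) - v (x, t) ≤ A + δ := by
  obtain ⟨M, hM, hmid⟩ := hH.exists_midpoint_le L
  have hcH : Continuous H := hH.1.continuous
  -- Half of `δ` pays for `a * L ^ 2`, the loss in replacing `L * ‖z‖` by `W (z, 0)`; the other half
  -- pays for `C * ‖ζ t - ξ t‖`. The resulting radius depends on `H`, `L` and `δ` only.
  set a : ℝ := δ / (2 * (L ^ 2 + 1))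
  have ha : 0 < a := by positivity
  have haL : a * L ^ 2 ≤ δ / 2 := by
    calc a * L ^ 2 ≤ a * (L ^ 2 + 1) := by gcongr; linarith
      _ = δ / 2 := by simp only [a]; field_simp
  obtain ⟨r, C, W, g, hr, hC, hgL, hW, hWL, hW0, hW00, hWC⟩ :=
    exists_envelope hcH hL ha hM hmid
  refine ⟨min (r / 2) (δ / (2 * (C + 1))), by positivity, ?_⟩
  intro ζ ξ u v A T hζ hξ hu hv hus hvs hinit hsmall x t ht htT
  have h := sub_le_add_of_multitime_solution (A := A + a * L ^ 2) hcH hC hgL hW hW0 hWC hζ hξ hu hv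
    hus hvs (fun x y => by have := hinit x y; have := hWL (x - y); linarith)
    (T := T) (fun s hs => ((hsmall s hs).trans (min_le_left _ _)).trans_lt (by linarith))
    (x₀ := x) ht htT
  have h2 := hWC 0 (ζ t - ξ t) 0
  have h3 : C * ‖ζ t - ξ t - 0‖ ≤ δ / 2 := by
    have := (hsmall t ⟨ht, htT.le⟩).trans (min_le_right _ _)
    rw [sub_zero]
    calc C * ‖ζ t - ξ t‖ ≤ (C + 1) * (δ / (2 * (C + 1))) := by gcongr; linarith
      _ = δ / 2 := by field_simp
  linarith

end Doubling

/-! ### Limits of approximate maxima -/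

section Stability

variable {d m : ℕ}

local notation "𝔼" => EuclideanSpace ℝ (Fin d)
local notation "𝔽" => EuclideanSpace ℝ (Fin m)

/-- Approximate maximizers converge to a strict maximizer of a continuous limit. -/
theorem tendsto_of_le_of_strict_max {X ι : Type*} [TopologicalSpace X] {l : Ultrafilter ι}
    {K : Set X} (hK : IsCompact K) {f : ι → X → ℝ} {f₀ : X → ℝ} {q₀ : X}
    (hf : ∀ q ∈ K, ∀ s : ι → X, (∀ᶠ n in l, s n ∈ K) → Tendsto s l (𝓝 q) →
      Tendsto (fun n => f n (s n)) l (𝓝 (f₀ q)))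
    (hq₀ : q₀ ∈ K) (hstrict : ∀ q ∈ K, f₀ q₀ ≤ f₀ q → q = q₀) {s s₀ : ι → X}
    (hsK : ∀ᶠ n in l, s n ∈ K) (hs₀K : ∀ᶠ n in l, s₀ n ∈ K) (hs₀ : Tendsto s₀ l (𝓝 q₀))
    (hle : ∀ᶠ n in l, f n (s₀ n) ≤ f n (s n)) : Tendsto s l (𝓝 q₀) := by
  obtain ⟨q, hqK, hq⟩ := hK.ultrafilter_le_nhds (l.map s) (le_principal_iff.2 hsK)
  have hq' : Tendsto s l (𝓝 q) := hq
  have := le_of_tendsto_of_tendsto (hf q₀ hq₀ s₀ hs₀K hs₀) (hf q hqK s hsK hq') hle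
  rwa [hstrict q hqK this] at hq'

/-- In the definition of subsolutions it suffices to consider strict maxima on small cylinders. -/
theorem isViscositySubsolution_of_strict {H : 𝔼 → 𝔽} {B : ℝ → 𝔽} {u : 𝔼 × ℝ → ℝ}
    (h : ∀ φ : 𝔼 × ℝ → ℝ, ContDiff ℝ 1 φ → ∀ (x : 𝔼) (t r : ℝ), 0 < r → r < t →
      (∀ q ∈ Metric.closedBall x r ×ˢ Icc (t - r) (t + r),
        u (x, t) - φ (x, t) ≤ u q - φ q → q = (x, t)) →
      ∀ p τ, HasFDerivAt φ (spaceTimeForm p τ) (x, t) → τ ≤ inner ℝ (H p) (deriv B t)) :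
    IsViscositySubsolution H B u := by
  intro φ hφ x t ht hmax
  obtain ⟨ε, hε, hball⟩ := Metric.eventually_nhds_iff_ball.1 hmax
  obtain ⟨p, τ, hd⟩ := hφ.exists_hasFDerivAt_spaceTimeForm (x, t)
  rw [hd.deriv_spaceTime, hd.gradient_spaceTime, drivenHamiltonian_eq_inner]
  -- The quadratic term makes the maximum strict without changing the first derivative at the
  -- contact point.
  let ψ : 𝔼 × ℝ → ℝ := fun q => φ q + (‖q.1 - x‖ ^ 2 + (q.2 - t) ^ 2)
  have hψ : ContDiff ℝ 1 ψ := by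
    have h1 := contDiff_norm_sq ℝ (E := 𝔼) (n := 1)
    have h2 : ContDiff ℝ 1 (fun q : 𝔼 × ℝ => ‖q.1 - x‖ ^ 2) :=
      h1.comp (contDiff_fst.sub contDiff_const)
    exact hφ.add (h2.add (by fun_prop))
  refine h ψ hψ x t (min (ε / 2) (t / 2)) (by positivity)
    ((min_le_right _ _).trans_lt (by linarith)) ?_ p τ ?_
  · rintro ⟨y, s⟩ ⟨hy, hs⟩ hle
    have hm1 := min_le_left (ε / 2) (t / 2)
    have hq := hball (y, s) (by
      rw [Metric.mem_ball, Prod.dist_eq, max_lt_iff]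
      simp only [Metric.mem_closedBall] at hy
      refine ⟨by linarith, ?_⟩
      rw [Real.dist_eq]
      have : |s - t| ≤ min (ε / 2) (t / 2) :=
        abs_le.2 ⟨by have := hs.1; simp only at this; linarith,
          by have := hs.2; simp only at this; linarith⟩
      linarith)
    simp only [ψ, sub_self, norm_zero] at hle
    have h1 : ‖y - x‖ ^ 2 + (s - t) ^ 2 ≤ 0 := by linarith
    have h2 : ‖y - x‖ ^ 2 = 0 := by nlinarith [sq_nonneg ‖y - x‖, sq_nonneg (s - t)]
    have h3 : (s - t) ^ 2 = 0 := by nlinarith [sq_nonneg ‖y - x‖, sq_nonneg (s - t)]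
    rw [sq_eq_zero_iff, norm_eq_zero, sub_eq_zero] at h2
    rw [sq_eq_zero_iff, sub_eq_zero] at h3
    rw [h2, h3]
  · have h1 : HasFDerivAt (fun q : 𝔼 × ℝ => ‖q.1 - x‖ ^ 2 + (q.2 - t) ^ 2) (spaceTimeForm 0 0)
        (x, t) := by
      have e1 : HasFDerivAt (fun q : 𝔼 × ℝ => q.1 - x) (ContinuousLinearMap.fst ℝ 𝔼 ℝ) (x, t) :=
        hasFDerivAt_fst.sub_const x
      have e2 : HasFDerivAt (fun q : 𝔼 × ℝ => ‖q.1 - x‖ ^ 2) (spaceTimeForm 0 0) (x, t) := by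
        refine e1.norm_sq.congr_fderiv (ContinuousLinearMap.ext fun v => ?_)
        simp
      have e3 : HasDerivAt (fun s : ℝ => (s - t) ^ 2) 0 t := by
        simpa using ((hasDerivAt_id t).sub_const t).fun_pow 2
      have := e2.add_spaceTimeForm (e3.hasFDerivAt_spaceTimeForm x)
      rwa [add_zero, add_zero] at this
    have := hd.add_spaceTimeForm h1
    rwa [add_zero, add_zero] at this

theorem isBUCSpaceTime_of_tendsto {ι : Type*} {l : Filter ι} [l.NeBot] {un : ι → 𝔼 × ℝ → ℝ}
    {u : 𝔼 × ℝ → ℝ} (hun : ∀ᶠ n in l, IsBUCSpaceTime (un n))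
    (hlim : ∀ T, 0 < T → TendstoUniformlyOn un u l (univ ×ˢ Icc 0 T)) : IsBUCSpaceTime u := by
  intro T hT
  constructor
  · obtain ⟨n, hn, hn'⟩ :=
      ((Metric.tendstoUniformlyOn_iff.1 (hlim T hT) 1 one_pos).and hun).exists
    obtain ⟨C, hC⟩ := (hn' T hT).1
    refine ⟨C + 1, fun q hq => ?_⟩
    have h1 := hC q hq
    have h2 := hn q hq
    rw [Real.dist_eq] at h2
    have := abs_sub_abs_le_abs_sub (u q) (un n q)
    linarith
  · exact (hlim T hT).uniformContinuousOn (hun.mono fun n hn => (hn T hT).2).frequently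

/-- Viscosity subsolutions are stable under locally uniform convergence. -/
theorem isViscositySubsolution_of_tendsto {H : 𝔼 → 𝔽} (hH : Continuous H) {B : ℝ → 𝔽}
    (hB : IsC1Path B) {un : ℕ → 𝔼 × ℝ → ℝ} {u : 𝔼 × ℝ → ℝ} (hun : ∀ n, IsBUCSpaceTime (un n))
    (hsub : ∀ n, IsViscositySubsolution H B (un n))
    (hlim : ∀ T, 0 < T → TendstoUniformlyOn un u atTop (univ ×ˢ Icc 0 T)) :
    IsViscositySubsolution H B u := by
  obtain ⟨b, hb, hdb⟩ := hB.exists_deriv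
  have hu := isBUCSpaceTime_of_tendsto (Eventually.of_forall hun) hlim
  refine isViscositySubsolution_of_strict fun φ hφ x t r hr hrt hstrict p τ hd => ?_
  have ht : 0 < t := hr.trans hrt
  set K : Set (𝔼 × ℝ) := Metric.closedBall x r ×ˢ Icc (t - r) (t + r) with hKdef
  have hK : IsCompact K := (isCompact_closedBall x r).prod isCompact_Icc
  have hKT : K ⊆ univ ×ˢ Icc 0 (t + r) := fun q hq => ⟨mem_univ _, by linarith [hq.2.1], hq.2.2⟩
  have hK0 : K ⊆ univ ×ˢ Ici 0 := fun q hq => ⟨mem_univ _, (hKT hq).2.1⟩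
  have hq₀ : (x, t) ∈ K := ⟨by simp [hr.le], by simp [hr.le]⟩
  have hKn : K ∈ 𝓝 (x, t) := prod_mem_nhds (Metric.closedBall_mem_nhds x hr)
    (Icc_mem_nhds (by linarith) (by linarith))
  -- Maximizers over the fixed compact `K` converge to the strict maximizer of the limit; they
  -- eventually lie in the interior, where the subsolution test applies.
  have hex : ∀ n, ∃ q ∈ K, ∀ z ∈ K, un n z - φ z ≤ un n q - φ q := fun n => by
    obtain ⟨q, hq, hqm⟩ := hK.exists_isMaxOn (f := fun q => un n q - φ q) ⟨_, hq₀⟩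
      (((hun n).continuousOn.mono hK0).sub hφ.continuous.continuousOn)
    exact ⟨q, hq, fun z hz => hqm hz⟩
  choose s hsK hsmax using hex
  have hs : Tendsto s (hyperfilter ℕ) (𝓝 (x, t)) := by
    refine tendsto_of_le_of_strict_max hK (f := fun n q => un n q - φ q)
      (f₀ := fun q => u q - φ q) ?_ hq₀ hstrict (Eventually.of_forall hsK)
      (s₀ := fun _ => (x, t)) (Eventually.of_forall fun _ => hq₀) tendsto_const_nhds
      (Eventually.of_forall fun n => hsmax n _ hq₀)
    intro q hq s hs hsq
    refine Tendsto.sub ?_ ((hφ.continuous.tendsto q).comp hsq)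
    have h1 : TendstoUniformlyOn un u (hyperfilter ℕ : Filter ℕ) K := fun v hv =>
      ((hlim (t + r) (by linarith)).mono hKT v hv).filter_mono Nat.hyperfilter_le_atTop
    exact h1.tendsto_comp ((hu.continuousOn.mono hK0) q hq)
      (tendsto_nhdsWithin_iff.2 ⟨hsq, hs⟩)
  obtain ⟨P, Θ, hP, hΘ, hPΘ⟩ := hφ.exists_continuous_spaceTimeForm
  have hKint : ∀ᶠ q in 𝓝 (x, t), K ∈ 𝓝 q := eventually_mem_nhds_iff.2 hKn
  have hineq : ∀ᶠ n in (hyperfilter ℕ : Filter ℕ),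
      Θ (s n) ≤ inner ℝ (H (P (s n))) (b (s n).2) := by
    filter_upwards [hs.eventually hKint] with n hn
    have hpos : 0 < (s n).2 := by linarith [(hsK n).2.1]
    have h1 := (hsub n).le_of_isLocalMax (φ := φ) (x := (s n).1) (t := (s n).2) hpos hφ.contDiffAt
      (by filter_upwards [hn] with z hz using hsmax n z hz) (hPΘ (s n))
    rwa [(hdb _ hpos).deriv] at h1
  have l1 : Tendsto (fun n => Θ (s n)) (hyperfilter ℕ) (𝓝 (Θ (x, t))) :=
    (hΘ.tendsto _).comp hs
  have hcont : Continuous (fun q : 𝔼 × ℝ => (inner ℝ (H (P q)) (b q.2) : ℝ)) := by fun_prop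
  have l2 := (hcont.tendsto (x, t)).comp hs
  have hfin := le_of_tendsto_of_tendsto l1 l2 hineq
  have e1 : τ = Θ (x, t) := hd.deriv_spaceTime.symm.trans (hPΘ (x, t)).deriv_spaceTime
  have e2 : p = P (x, t) := hd.gradient_spaceTime.symm.trans (hPΘ (x, t)).gradient_spaceTime
  rw [e1, e2, (hdb t ht).deriv]
  exact hfin

theorem isViscositySupersolution_of_tendsto {H : 𝔼 → 𝔽} (hH : Continuous H) {B : ℝ → 𝔽}
    (hB : IsC1Path B) {un : ℕ → 𝔼 × ℝ → ℝ} {u : 𝔼 × ℝ → ℝ} (hun : ∀ n, IsBUCSpaceTime (un n))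
    (hsup : ∀ n, IsViscositySupersolution H B (un n))
    (hlim : ∀ T, 0 < T → TendstoUniformlyOn un u atTop (univ ×ˢ Icc 0 T)) :
    IsViscositySupersolution H B u := by
  refine IsViscositySupersolution.of_neg (isViscositySubsolution_of_tendsto
    (un := fun n q => -un n q) (by fun_prop) hB (fun n T hT => ?_) (fun n => (hsup n).neg)
    fun T hT => ?_)
  · obtain ⟨⟨C, hC⟩, h2⟩ := hun n T hT
    exact ⟨⟨C, fun q hq => by rw [abs_neg]; exact hC q hq⟩,
      uniformContinuous_neg.comp_uniformContinuousOn h2⟩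
  · exact (hlim T hT).neg

end Stability

/-! ### A monotone finite difference scheme -/

section Scheme

variable {d m : ℕ}

local notation "𝔼" => EuclideanSpace ℝ (Fin d)
local notation "𝔽" => EuclideanSpace ℝ (Fin m)

/-- The standard basis vectors. -/
noncomputable def stdVec (i : Fin d) : 𝔼 := EuclideanSpace.single i 1

theorem norm_stdVec (i : Fin d) : ‖(stdVec i : 𝔼)‖ = 1 := by simp [stdVec]

/-- Central difference quotients. -/
noncomputable def centralGradient (ρ : ℝ) (U : 𝔼 → ℝ) (x : 𝔼) : 𝔼 :=
  WithLp.toLp 2 fun i => (U (x + ρ • stdVec i) - U (x - ρ • stdVec i)) / (2 * ρ)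

/-- The viscosity coefficient of the Lax–Friedrichs scheme. -/
noncomputable def lfCoeff (d : ℕ) : ℝ := 1 / (2 * (d + 1))

theorem lfCoeff_pos (d : ℕ) : 0 < lfCoeff d := by unfold lfCoeff; positivity

/-- Outside the Hamiltonian term the centre value carries weight `1 - 2 * (d * lfCoeff d)` in
`lfStep`; monotonicity needs it nonnegative. -/
theorem two_mul_lfCoeff_le (d : ℕ) : 2 * (d * lfCoeff d) ≤ 1 := by
  unfold lfCoeff
  rw [mul_one_div, ← mul_div_assoc, div_le_one (by positivity)]
  linarith

/-- One step of the Lax–Friedrichs scheme for `U_t = G(DU)`. -/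
noncomputable def lfStep (G : 𝔼 → ℝ) (h ρ : ℝ) (U : 𝔼 → ℝ) (x : 𝔼) : ℝ :=
  U x + lfCoeff d * ∑ i, (U (x + ρ • stdVec i) + U (x - ρ • stdVec i) - 2 * U x)
    + h * G (centralGradient ρ U x)

theorem EuclideanSpace.norm_le_sum_abs (p : 𝔼) : ‖p‖ ≤ ∑ i, |p i| := by
  conv_lhs => rw [← (EuclideanSpace.basisFun (Fin d) ℝ).sum_repr p]
  refine (norm_sum_le _ _).trans (le_of_eq (Finset.sum_congr rfl fun i _ => ?_))
  rw [norm_smul, OrthonormalBasis.norm_eq_one, mul_one]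
  rfl

/-- The scheme is monotone, and local. -/
theorem lfStep_le_lfStep_add {G : 𝔼 → ℝ} {M h ρ : ℝ} (hM : 0 ≤ M)
    (hG : ∀ p q, |G p - G q| ≤ M * ‖p - q‖) (hh : 0 < h) (hρ : 0 < ρ)
    (hcfl : h * M ≤ 2 * ρ * lfCoeff d) {U V : 𝔼 → ℝ} {a : ℝ} {x : 𝔼} (h0 : U x ≤ V x + a)
    (h1 : ∀ i, U (x + ρ • stdVec i) ≤ V (x + ρ • stdVec i) + a)
    (h2 : ∀ i, U (x - ρ • stdVec i) ≤ V (x - ρ • stdVec i) + a) :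
    lfStep G h ρ U x ≤ lfStep G h ρ V x + a := by
  set c := lfCoeff d with hc
  have hc0 : 0 < c := lfCoeff_pos d
  set D : ℝ := V x + a - U x with hD
  set Dp : Fin d → ℝ := fun i => V (x + ρ • stdVec i) + a - U (x + ρ • stdVec i) with hDp
  set Dm : Fin d → ℝ := fun i => V (x - ρ • stdVec i) + a - U (x - ρ • stdVec i) with hDm
  have hD0 : 0 ≤ D := by simp only [hD]; linarith
  have hDp0 : ∀ i, 0 ≤ Dp i := fun i => by have := h1 i; simp only [hDp]; linarith
  have hDm0 : ∀ i, 0 ≤ Dm i := fun i => by have := h2 i; simp only [hDm]; linarith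
  have hgrad : ‖centralGradient ρ U x - centralGradient ρ V x‖
      ≤ ∑ i, (Dp i + Dm i) / (2 * ρ) := by
    refine (EuclideanSpace.norm_le_sum_abs _).trans (Finset.sum_le_sum fun i _ => ?_)
    have : (centralGradient ρ U x - centralGradient ρ V x) i = (Dm i - Dp i) / (2 * ρ) := by
      simp only [PiLp.sub_apply, centralGradient, hDm, hDp]
      ring
    rw [this, abs_div, abs_of_pos (by positivity : 0 < 2 * ρ)]
    have h3 := hDp0 i
    have h4 := hDm0 i
    gcongr
    rw [abs_le]
    constructor <;> linarith
  -- Under the CFL condition the change in the Hamiltonian term is absorbed by the weights `c` of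
  -- the neighbouring values.
  have hGd : h * (G (centralGradient ρ U x) - G (centralGradient ρ V x))
      ≤ c * ∑ i, (Dp i + Dm i) := by
    calc h * (G (centralGradient ρ U x) - G (centralGradient ρ V x))
        ≤ h * (M * ∑ i, (Dp i + Dm i) / (2 * ρ)) := by
          gcongr
          exact ((le_abs_self _).trans (hG _ _)).trans (by gcongr)
      _ = h * M / (2 * ρ) * ∑ i, (Dp i + Dm i) := by
          rw [← Finset.sum_div]; ring
      _ ≤ c * ∑ i, (Dp i + Dm i) := by
          have : 0 ≤ ∑ i, (Dp i + Dm i) := Finset.sum_nonneg fun i _ => add_nonneg (hDp0 i) (hDm0 i)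
          gcongr
          rw [div_le_iff₀ (by positivity)]
          linarith
  have hsum : ∑ i, (V (x + ρ • stdVec i) + V (x - ρ • stdVec i) - 2 * V x)
      - ∑ i, (U (x + ρ • stdVec i) + U (x - ρ • stdVec i) - 2 * U x)
      = ∑ i, (Dp i + Dm i) - d * (2 * D) := by
    rw [← Finset.sum_sub_distrib]
    have : (d : ℝ) * (2 * D) = ∑ _i : Fin d, 2 * D := by simp
    rw [this, ← Finset.sum_sub_distrib]
    refine Finset.sum_congr rfl fun i _ => ?_
    simp only [hDp, hDm, hD]
    ring
  have h2c := two_mul_lfCoeff_le d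
  rw [← hc] at h2c
  have key : 0 ≤ D * (1 - 2 * (d * c)) := mul_nonneg hD0 (by linarith)
  have hsum' := congrArg (c * ·) hsum
  simp only [mul_sub] at hsum' hGd
  simp only [lfStep, ← hc]
  have hDe : V x + a - U x = D := rfl
  nlinarith

/-- With monotonicity, translation invariance gives preservation of the Lipschitz constant. -/
theorem lfStep_translate (G : 𝔼 → ℝ) (h ρ : ℝ) (U : 𝔼 → ℝ) (z x : 𝔼) :
    lfStep G h ρ (fun y => U (y + z)) x = lfStep G h ρ U (x + z) := by
  simp only [lfStep, centralGradient, add_right_comm x _ z, add_sub_right_comm x z]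

/-- This reflection reduces the supersolution property of the limit to the subsolution property. -/
theorem lfStep_neg (G : 𝔼 → ℝ) (h ρ : ℝ) (U : 𝔼 → ℝ) (x : 𝔼) :
    lfStep (fun p => -G (-p)) h ρ (fun y => -U y) x = -lfStep G h ρ U x := by
  have : -centralGradient ρ (fun y => -U y) x = centralGradient ρ U x := by
    ext i
    simp only [centralGradient, PiLp.neg_apply]
    ring
  simp only [lfStep, this]
  rw [neg_add, neg_add, ← mul_neg, ← Finset.sum_neg_distrib]
  congr 1
  · congr 2
    exact Finset.sum_congr rfl fun i _ => by ring
  · ring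

/-- The scheme does not increase the Lipschitz constant. -/
theorem lfStep_lipschitz {G : 𝔼 → ℝ} {M h ρ L : ℝ} (hM : 0 ≤ M)
    (hG : ∀ p q, |G p - G q| ≤ M * ‖p - q‖) (hh : 0 < h) (hρ : 0 < ρ)
    (hcfl : h * M ≤ 2 * ρ * lfCoeff d) {U : 𝔼 → ℝ} (hU : ∀ x y, U x ≤ U y + L * ‖x - y‖) (x y : 𝔼) :
    lfStep G h ρ U x ≤ lfStep G h ρ U y + L * ‖x - y‖ := by
  have h1 : ∀ z, U (z + (x - y)) ≤ U z + L * ‖x - y‖ := fun z => by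
    simpa using hU (z + (x - y)) z
  have := lfStep_le_lfStep_add (U := fun z => U (z + (x - y))) (V := U) (x := y) hM hG hh hρ hcfl
    (h1 _) (fun i => h1 _) (fun i => h1 _)
  rwa [lfStep_translate, add_sub_cancel] at this

/-- For Lipschitz `U` the second differences are of order `ρ` and the central gradient is bounded.
With `ρ` proportional to `h`, a step moves by a multiple of `h`. -/
theorem abs_lfStep_sub_le {G : 𝔼 → ℝ} {M h ρ L : ℝ} (hM : 0 ≤ M)
    (hG : ∀ p q, |G p - G q| ≤ M * ‖p - q‖) (hh : 0 < h) (hρ : 0 < ρ) (hL : 0 ≤ L)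
    {U : 𝔼 → ℝ} (hU : ∀ x y, U x ≤ U y + L * ‖x - y‖) (x : 𝔼) :
    |lfStep G h ρ U x - U x| ≤ L * ρ + h * (|G 0| + M * (d * L)) := by
  have hU' : ∀ x y, |U x - U y| ≤ L * ‖x - y‖ := fun x y => by
    have e1 := hU x y
    have e2 := hU y x
    rw [norm_sub_rev y x] at e2
    exact abs_le.2 ⟨by linarith, by linarith⟩
  have hn : ∀ i : Fin d, ‖ρ • (stdVec i : 𝔼)‖ = ρ := fun i => by
    rw [norm_smul, norm_stdVec, mul_one, Real.norm_of_nonneg hρ.le]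
  have h1 : |∑ i, (U (x + ρ • stdVec i) + U (x - ρ • stdVec i) - 2 * U x)| ≤ d * (2 * (L * ρ)) := by
    refine (Finset.abs_sum_le_sum_abs _ _).trans ?_
    refine (Finset.sum_le_card_nsmul _ _ (2 * (L * ρ)) fun i _ => ?_).trans (by simp)
    have e1 := hU' (x + ρ • stdVec i) x
    have e2 := hU' (x - ρ • stdVec i) x
    rw [add_sub_cancel_left, hn] at e1
    rw [sub_sub_cancel_left, norm_neg, hn] at e2
    rw [abs_le] at *
    constructor <;> linarith [e1.1, e1.2, e2.1, e2.2]
  have h2 : ‖centralGradient ρ U x‖ ≤ d * L := by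
    refine (EuclideanSpace.norm_le_sum_abs _).trans ?_
    refine (Finset.sum_le_card_nsmul _ _ L fun i _ => ?_).trans (by simp)
    have e1 := hU' (x + ρ • stdVec i) (x - ρ • stdVec i)
    have e2 : ‖x + ρ • stdVec i - (x - ρ • stdVec i)‖ ≤ 2 * ρ := by
      have : x + ρ • stdVec i - (x - ρ • stdVec i) = ρ • (stdVec i : 𝔼) + ρ • stdVec i := by abel
      rw [this]
      exact (norm_add_le _ _).trans (by rw [hn]; linarith)
    simp only [centralGradient]
    rw [abs_div, abs_of_pos (by positivity : 0 < 2 * ρ), div_le_iff₀ (by positivity)]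
    exact e1.trans (by gcongr)
  have h3 : |G (centralGradient ρ U x)| ≤ |G 0| + M * (d * L) := by
    have e1 := hG (centralGradient ρ U x) 0
    rw [sub_zero] at e1
    have e2 := abs_sub_abs_le_abs_sub (G (centralGradient ρ U x)) (G 0)
    have e3 : M * ‖centralGradient ρ U x‖ ≤ M * (d * L) := by gcongr
    linarith
  have h4 : |lfCoeff d * ∑ i, (U (x + ρ • stdVec i) + U (x - ρ • stdVec i) - 2 * U x)|
      ≤ L * ρ := by
    rw [abs_mul, abs_of_pos (lfCoeff_pos d)]
    have := lfCoeff_pos d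
    calc _ ≤ lfCoeff d * (d * (2 * (L * ρ))) := by gcongr
      _ = 2 * (d * lfCoeff d) * (L * ρ) := by ring
      _ ≤ 1 * (L * ρ) := by gcongr; exact two_mul_lfCoeff_le d
      _ = L * ρ := one_mul _
  have h5 : |h * G (centralGradient ρ U x)| ≤ h * (|G 0| + M * (d * L)) := by
    rw [abs_mul, abs_of_pos hh]
    gcongr
  have : lfStep G h ρ U x - U x
      = lfCoeff d * ∑ i, (U (x + ρ • stdVec i) + U (x - ρ • stdVec i) - 2 * U x)
        + h * G (centralGradient ρ U x) := by
    simp only [lfStep]; ring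
  rw [this]
  exact (abs_add_le _ _).trans (by linarith)

/-- Difference quotients with moving base points. -/
theorem HasStrictFDerivAt.tendsto_div {X ι : Type*} [NormedAddCommGroup X] [NormedSpace ℝ X]
    {φ : X → ℝ} {φ' : X →L[ℝ] ℝ} {q : X} (hφ : HasStrictFDerivAt φ φ' q) {l : Filter ι}
    {a b w : ι → X} {h : ι → ℝ} {w₀ : X} (ha : Tendsto a l (𝓝 q)) (hb : Tendsto b l (𝓝 q))
    (hw : Tendsto w l (𝓝 w₀)) (hab : ∀ᶠ n in l, a n - b n = h n • w n) (hh : ∀ᶠ n in l, h n ≠ 0) :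
    Tendsto (fun n => (φ (a n) - φ (b n)) / h n) l (𝓝 (φ' w₀)) := by
  have h1 : Tendsto (fun n => φ' (w n)) l (𝓝 (φ' w₀)) := (φ'.continuous.tendsto w₀).comp hw
  have h2 : Tendsto (fun n => (φ (a n) - φ (b n)) / h n - φ' (w n)) l (𝓝 0) := by
    have h3 := hφ.isLittleO.comp_tendsto (ha.prodMk_nhds hb)
    rw [← Asymptotics.isLittleO_one_iff ℝ]
    have h4 : (fun n => (φ (a n) - φ (b n)) / h n - φ' (w n)) =o[l] w := by
      rw [Asymptotics.isLittleO_iff] at h3 ⊢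
      intro c hc
      filter_upwards [h3 hc, hab, hh] with n hn hn' hn0
      simp only [Function.comp, hn', map_smul, smul_eq_mul, norm_smul] at hn
      have e : (φ (a n) - φ (b n)) / h n - φ' (w n)
          = (φ (a n) - φ (b n) - h n * φ' (w n)) / h n := by field_simp
      rw [e, norm_div, div_le_iff₀ (norm_pos_iff.2 hn0)]
      linarith
    exact h4.trans_isBigO (hw.isBigO_one ℝ)
  simpa using h2.add h1

end Scheme

/-! ### Existence for Lipschitz data -/

section SchemeLimit

variable {d m : ℕ}

local notation "𝔼" => EuclideanSpace ℝ (Fin d)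
local notation "𝔽" => EuclideanSpace ℝ (Fin m)

/-- The ratio of the mesh sizes in space and time, at time `t`. -/
noncomputable def lfRatio (d : ℕ) (k : ℝ) (b : ℝ → 𝔽) (t : ℝ) : ℝ :=
  (k * ‖b t‖ + 1) / (2 * lfCoeff d)

/-- The Lax–Friedrichs approximations at the times `n * h`. -/
noncomputable def lfIter (H : 𝔼 → 𝔽) (k : ℝ) (b : ℝ → 𝔽) (h : ℝ) (u₀ : 𝔼 → ℝ) : ℕ → 𝔼 → ℝ
  | 0 => u₀
  | n + 1 => lfStep (fun p => inner ℝ (H p) (b (n * h))) h (h * lfRatio d k b (n * h))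
      (lfIter H k b h u₀ n)

/-- The Lax–Friedrichs approximation, piecewise constant in time. -/
noncomputable def lfApprox (H : 𝔼 → 𝔽) (k : ℝ) (b : ℝ → 𝔽) (h : ℝ) (u₀ : 𝔼 → ℝ)
    (q : 𝔼 × ℝ) : ℝ :=
  lfIter H k b h u₀ ⌊q.2 / h⌋₊ q.1

variable {H : EuclideanSpace ℝ (Fin d) → EuclideanSpace ℝ (Fin m)} {k : ℝ}
  {b : ℝ → EuclideanSpace ℝ (Fin m)} {u₀ : EuclideanSpace ℝ (Fin d) → ℝ} {L : ℝ}

theorem lfRatio_pos (hk : 0 ≤ k) (t : ℝ) : 0 < lfRatio d k b t := by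
  have := lfCoeff_pos d
  unfold lfRatio
  positivity

theorem continuous_lfRatio (hb : Continuous b) : Continuous (lfRatio d k b) := by
  unfold lfRatio
  fun_prop

/-- `lfRatio` is built for this CFL condition, `k * ‖b t‖` being the Lipschitz constant of the
Hamiltonian at time `t`; its summand 1 keeps the spatial mesh positive when `b t = 0`. -/
theorem lfRatio_cfl (k : ℝ) (b : ℝ → 𝔽) (t : ℝ) {h : ℝ} (hh : 0 < h) :
    h * (k * ‖b t‖) ≤ 2 * (h * lfRatio d k b t) * lfCoeff d := by
  have := lfCoeff_pos d
  have e : 2 * (h * lfRatio d k b t) * lfCoeff d = h * (k * ‖b t‖ + 1) := by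
    unfold lfRatio
    field_simp
  rw [e]
  gcongr
  linarith

theorem abs_inner_sub_inner_le (hH : ∀ p q, ‖H p - H q‖ ≤ k * ‖p - q‖) (v : 𝔽) (p q : 𝔼) :
    |inner ℝ (H p) v - inner ℝ (H q) v| ≤ k * ‖v‖ * ‖p - q‖ := by
  rw [← inner_sub_left]
  calc _ ≤ ‖H p - H q‖ * ‖v‖ := abs_real_inner_le_norm _ _
    _ ≤ k * ‖p - q‖ * ‖v‖ := by gcongr; exact hH p q
    _ = _ := by ring

theorem lfIter_lipschitz (hk : 0 ≤ k) (hH : ∀ p q, ‖H p - H q‖ ≤ k * ‖p - q‖)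
    (hu₀ : ∀ x y, u₀ x ≤ u₀ y + L * ‖x - y‖) {h : ℝ} (hh : 0 < h) (n : ℕ) (x y : 𝔼) :
    lfIter H k b h u₀ n x ≤ lfIter H k b h u₀ n y + L * ‖x - y‖ := by
  induction n generalizing x y with
  | zero => exact hu₀ x y
  | succ n ih =>
    exact lfStep_lipschitz (by positivity) (abs_inner_sub_inner_le hH _) hh
      (mul_pos hh (lfRatio_pos hk _)) (lfRatio_cfl k b _ hh) ih x y

theorem lfIter_neg (k : ℝ) (b : ℝ → 𝔽) (h : ℝ) (n : ℕ) (x : 𝔼) :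
    lfIter (fun p => -H (-p)) k b h (fun y => -u₀ y) n x = -lfIter H k b h u₀ n x := by
  induction n generalizing x with
  | zero => rfl
  | succ n ih =>
    simp only [lfIter]
    rw [funext ih]
    simp only [inner_neg_left]
    exact lfStep_neg (fun p => inner ℝ (H p) (b (n * h))) _ _ _ _

theorem exists_abs_lfIter_sub_le (hk : 0 ≤ k) (hH : ∀ p q, ‖H p - H q‖ ≤ k * ‖p - q‖)
    (hb : Continuous b) (hL : 0 ≤ L) (hu₀ : ∀ x y, u₀ x ≤ u₀ y + L * ‖x - y‖) (T : ℝ) :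
    ∃ Γ, 0 ≤ Γ ∧ ∀ h, 0 < h → ∀ i j : ℕ, i ≤ j → j * h ≤ T → ∀ x,
      |lfIter H k b h u₀ j x - lfIter H k b h u₀ i x| ≤ Γ * ((j - i) * h) := by
  have hcr : Continuous fun t => L * lfRatio d k b t
      + (|inner ℝ (H 0) (b t)| + k * ‖b t‖ * (d * L)) := by
    have := continuous_lfRatio (d := d) (k := k) hb
    fun_prop
  obtain ⟨Γ, hΓ⟩ := (isCompact_Icc (a := (0 : ℝ)) (b := T)).exists_bound_of_continuousOn
    hcr.continuousOn
  refine ⟨max Γ 0, le_max_right _ _, fun h hh i j hij => ?_⟩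
  induction j, hij using Nat.le_induction with
  | base => intro _ x; simp
  | succ j hij ih =>
    intro hjT x
    push_cast at hjT
    have hj : (j : ℝ) * h ≤ T := by nlinarith
    have h1 := ih hj x
    have h2 := abs_lfStep_sub_le (h := h) (by positivity) (abs_inner_sub_inner_le hH (b (j * h))) hh
      (mul_pos hh (lfRatio_pos (d := d) (b := b) hk (j * h))) hL
      (lfIter_lipschitz (b := b) hk hH hu₀ hh j) x
    have h3 := (le_abs_self _).trans (hΓ (j * h) ⟨by positivity, hj⟩)
    have h4 : |lfIter H k b h u₀ (j + 1) x - lfIter H k b h u₀ j x| ≤ max Γ 0 * h := by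
      refine h2.trans ?_
      have := h3.trans (le_max_left Γ 0)
      calc _ = (L * lfRatio d k b (j * h)
            + (|inner ℝ (H 0) (b (j * h))| + k * ‖b (j * h)‖ * (d * L))) * h := by ring
        _ ≤ _ := by gcongr
    have h5 := abs_sub_le (lfIter H k b h u₀ (j + 1) x) (lfIter H k b h u₀ j x)
      (lfIter H k b h u₀ i x)
    push_cast
    calc _ ≤ _ := h5
      _ ≤ max Γ 0 * h + max Γ 0 * ((j - i) * h) := add_le_add h4 h1
      _ = _ := by ring

/-- The extra `h` absorbs the rounding of times to the grid. As `Γ` does not depend on `h`, this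
acts as equicontinuity in the limit. -/
theorem exists_abs_lfApprox_sub_le (hk : 0 ≤ k) (hH : ∀ p q, ‖H p - H q‖ ≤ k * ‖p - q‖)
    (hb : Continuous b) (hL : 0 ≤ L) (hu₀ : ∀ x y, u₀ x ≤ u₀ y + L * ‖x - y‖) (T : ℝ) :
    ∃ Γ, 0 ≤ Γ ∧ ∀ h, 0 < h → ∀ x y, ∀ t ∈ Icc 0 T, ∀ s ∈ Icc 0 T,
      |lfApprox H k b h u₀ (x, t) - lfApprox H k b h u₀ (y, s)|
        ≤ L * ‖x - y‖ + Γ * (|t - s| + h) := by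
  obtain ⟨Γ, hΓ0, hΓ⟩ := exists_abs_lfIter_sub_le hk hH hb hL hu₀ T
  refine ⟨Γ, hΓ0, fun h hh x y => ?_⟩
  have hfl : ∀ t, 0 ≤ t → ⌊t / h⌋₊ * h ≤ t := fun t ht => by
    rw [← le_div_iff₀ hh]
    exact Nat.floor_le (by positivity)
  have hfu : ∀ t, t ≤ ⌊t / h⌋₊ * h + h := fun t => by
    have := (Nat.lt_floor_add_one (t / h)).le
    rw [div_le_iff₀ hh] at this
    linarith
  have htime : ∀ z : 𝔼, ∀ t ∈ Icc 0 T, ∀ s ∈ Icc 0 T, s ≤ t →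
      |lfApprox H k b h u₀ (z, t) - lfApprox H k b h u₀ (z, s)| ≤ Γ * (|t - s| + h) := by
    intro z t ht s hs hst
    refine (hΓ h hh _ _ (Nat.floor_mono (by gcongr)) ((hfl t ht.1).trans ht.2) z).trans ?_
    gcongr
    have e1 := hfl t ht.1
    have e2 := hfu s
    have e3 := le_abs_self (t - s)
    rw [sub_mul]
    linarith
  intro t ht s hs
  have h1 : |lfApprox H k b h u₀ (x, t) - lfApprox H k b h u₀ (y, t)| ≤ L * ‖x - y‖ := by
    have e1 := lfIter_lipschitz (b := b) hk hH hu₀ hh ⌊t / h⌋₊ x y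
    have e2 := lfIter_lipschitz (b := b) hk hH hu₀ hh ⌊t / h⌋₊ y x
    rw [norm_sub_rev y x] at e2
    simp only [lfApprox]
    exact abs_le.2 ⟨by linarith, by linarith⟩
  have h2 : |lfApprox H k b h u₀ (y, t) - lfApprox H k b h u₀ (y, s)| ≤ Γ * (|t - s| + h) := by
    rcases le_total s t with hst | hst
    · exact htime y t ht s hs hst
    · rw [abs_sub_comm, abs_sub_comm t s]
      exact htime y s hs t ht hst
  exact (abs_sub_le _ _ _).trans (add_le_add h1 h2)

/-- The mesh sizes along which the limit is taken. -/
noncomputable def meshSize (n : ℕ) : ℝ := 1 / ((n : ℝ) + 1)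

theorem meshSize_pos (n : ℕ) : 0 < meshSize n := by unfold meshSize; positivity

theorem meshSize_le_one (n : ℕ) : meshSize n ≤ 1 := by
  unfold meshSize
  rw [div_le_one (by positivity)]
  have : (0 : ℝ) ≤ n := by positivity
  linarith

theorem tendsto_meshSize : Tendsto meshSize (hyperfilter ℕ) (𝓝 0) :=
  tendsto_one_div_add_atTop_nhds_zero_nat.mono_left Nat.hyperfilter_le_atTop

/-- Convergence along one ultrafilter replaces the extraction of a subsequence: boundedness at each
point suffices. -/
theorem exists_lfLimit (hk : 0 ≤ k) (hH : ∀ p q, ‖H p - H q‖ ≤ k * ‖p - q‖)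
    (hb : Continuous b) (hL : 0 ≤ L) (hu₀ : ∀ x y, u₀ x ≤ u₀ y + L * ‖x - y‖) :
    ∃ u : 𝔼 × ℝ → ℝ, ∀ q, Tendsto (fun n => lfApprox H k b (meshSize n) u₀ q) (hyperfilter ℕ)
      (𝓝 (u q)) := by
  suffices h : ∀ q : 𝔼 × ℝ, ∃ c, Tendsto (fun n => lfApprox H k b (meshSize n) u₀ q)
      (hyperfilter ℕ) (𝓝 c) from ⟨fun q => (h q).choose, fun q => (h q).choose_spec⟩
  rintro ⟨x, t⟩
  obtain ⟨C, hC⟩ : ∃ C, ∀ n, |lfApprox H k b (meshSize n) u₀ (x, t)| ≤ C := by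
    rcases lt_or_ge t 0 with ht | ht
    · refine ⟨|u₀ x|, fun n => ?_⟩
      have : ⌊t / meshSize n⌋₊ = 0 :=
        Nat.floor_of_nonpos (div_nonpos_of_nonpos_of_nonneg ht.le (meshSize_pos n).le)
      simp [lfApprox, this, lfIter]
    · obtain ⟨Γ, hΓ0, hΓ⟩ := exists_abs_lfApprox_sub_le hk hH hb hL hu₀ t
      refine ⟨|u₀ x| + Γ * (t + 1), fun n => ?_⟩
      have h1 := hΓ _ (meshSize_pos n) x x t ⟨ht, le_rfl⟩ 0 ⟨le_rfl, ht⟩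
      have h0 : lfApprox H k b (meshSize n) u₀ (x, 0) = u₀ x := by simp [lfApprox, lfIter]
      rw [h0, sub_self, norm_zero, mul_zero, zero_add, sub_zero, abs_of_nonneg ht] at h1
      have h2 := abs_sub_abs_le_abs_sub (lfApprox H k b (meshSize n) u₀ (x, t)) (u₀ x)
      have h3 : Γ * (t + meshSize n) ≤ Γ * (t + 1) := by gcongr; exact meshSize_le_one n
      linarith
  obtain ⟨c, -, hc⟩ := (isCompact_Icc (a := -C) (b := C)).ultrafilter_le_nhds
    ((hyperfilter ℕ).map fun n => lfApprox H k b (meshSize n) u₀ (x, t))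
    (le_principal_iff.2 (Filter.mem_map.2 (Filter.univ_mem' fun n => abs_le.1 (hC n))))
  exact ⟨c, hc⟩

variable {u : EuclideanSpace ℝ (Fin d) × ℝ → ℝ}

theorem exists_abs_lfLimit_sub_le (hk : 0 ≤ k) (hH : ∀ p q, ‖H p - H q‖ ≤ k * ‖p - q‖)
    (hb : Continuous b) (hL : 0 ≤ L) (hu₀ : ∀ x y, u₀ x ≤ u₀ y + L * ‖x - y‖)
    (hu : ∀ q, Tendsto (fun n => lfApprox H k b (meshSize n) u₀ q) (hyperfilter ℕ) (𝓝 (u q)))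
    (T : ℝ) :
    ∃ Γ, 0 ≤ Γ ∧ ∀ x y, ∀ t ∈ Icc 0 T, ∀ s ∈ Icc 0 T,
      |u (x, t) - u (y, s)| ≤ L * ‖x - y‖ + Γ * |t - s| := by
  obtain ⟨Γ, hΓ0, hΓ⟩ := exists_abs_lfApprox_sub_le hk hH hb hL hu₀ T
  refine ⟨Γ, hΓ0, fun x y t ht s hs => ?_⟩
  have h1 := ((hu (x, t)).sub (hu (y, s))).abs
  have h2 : Tendsto (fun n => L * ‖x - y‖ + Γ * (|t - s| + meshSize n)) (hyperfilter ℕ)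
      (𝓝 (L * ‖x - y‖ + Γ * (|t - s| + 0))) :=
    ((tendsto_meshSize.const_add _).const_mul _).const_add _
  rw [add_zero] at h2
  exact le_of_tendsto_of_tendsto' h1 h2 fun n => hΓ _ (meshSize_pos n) x y t ht s hs

/-- Equicontinuity upgrades pointwise convergence to convergence at moving points, as needed for the
grid maximizers. -/
theorem tendsto_lfApprox (hk : 0 ≤ k) (hH : ∀ p q, ‖H p - H q‖ ≤ k * ‖p - q‖)
    (hb : Continuous b) (hL : 0 ≤ L) (hu₀ : ∀ x y, u₀ x ≤ u₀ y + L * ‖x - y‖)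
    (hu : ∀ q, Tendsto (fun n => lfApprox H k b (meshSize n) u₀ q) (hyperfilter ℕ) (𝓝 (u q)))
    {T : ℝ} {q : 𝔼 × ℝ} (hq : q.2 ∈ Icc 0 T) {s : ℕ → 𝔼 × ℝ}
    (hs : ∀ᶠ n in (hyperfilter ℕ : Filter ℕ), (s n).2 ∈ Icc 0 T)
    (hsq : Tendsto s (hyperfilter ℕ) (𝓝 q)) :
    Tendsto (fun n => lfApprox H k b (meshSize n) u₀ (s n)) (hyperfilter ℕ) (𝓝 (u q)) := by
  obtain ⟨Γ, hΓ0, hΓ⟩ := exists_abs_lfApprox_sub_le hk hH hb hL hu₀ T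
  have h1 : Tendsto (fun n => L * ‖(s n).1 - q.1‖ + Γ * (|(s n).2 - q.2| + meshSize n))
      (hyperfilter ℕ) (𝓝 (L * ‖q.1 - q.1‖ + Γ * (|q.2 - q.2| + 0))) := by
    have e1 : Tendsto (fun n => (s n).1) (hyperfilter ℕ) (𝓝 q.1) :=
      (continuous_fst.tendsto q).comp hsq
    have e2 : Tendsto (fun n => (s n).2) (hyperfilter ℕ) (𝓝 q.2) :=
      (continuous_snd.tendsto q).comp hsq
    exact ((e1.sub_const _).norm.const_mul _).add
      (((e2.sub_const _).abs.add tendsto_meshSize).const_mul _)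
  simp only [sub_self, norm_zero, mul_zero, abs_zero, add_zero] at h1
  have h2 : Tendsto (fun n => lfApprox H k b (meshSize n) u₀ (s n)
      - lfApprox H k b (meshSize n) u₀ q) (hyperfilter ℕ) (𝓝 0) := by
    refine squeeze_zero_norm' ?_ h1
    filter_upwards [hs] with n hn
    exact hΓ _ (meshSize_pos n) _ _ _ hn _ hq
  simpa using h2.add (hu q)

/-- Limits of the scheme are viscosity subsolutions. -/
theorem isViscositySubsolution_lfLimit (hk : 0 ≤ k) (hH : ∀ p q, ‖H p - H q‖ ≤ k * ‖p - q‖)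
    (hHc : Continuous H) (hb : Continuous b) (hL : 0 ≤ L)
    (hu₀ : ∀ x y, u₀ x ≤ u₀ y + L * ‖x - y‖)
    (hu : ∀ q, Tendsto (fun n => lfApprox H k b (meshSize n) u₀ q) (hyperfilter ℕ) (𝓝 (u q)))
    {B : ℝ → 𝔽} (hB : ∀ t, 0 < t → HasDerivAt B (b t) t) : IsViscositySubsolution H B u := by
  refine isViscositySubsolution_of_strict fun φ hφ x t r hr hrt hstrict p τ hd => ?_
  have ht : 0 < t := hr.trans hrt
  rw [(hB t ht).deriv]
  set 𝓤 : Filter ℕ := (hyperfilter ℕ : Filter ℕ) with hU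
  set K : Set (𝔼 × ℝ) := Metric.closedBall x r ×ˢ Icc (t - r) (t + r) with hKdef
  have hK : IsCompact K := (isCompact_closedBall x r).prod isCompact_Icc
  have hKT : ∀ q ∈ K, q.2 ∈ Icc 0 (t + r) := fun q hq => ⟨by linarith [hq.2.1], hq.2.2⟩
  have hq₀ : (x, t) ∈ K := ⟨by simp [hr.le], by simp [hr.le]⟩
  have hKn : K ∈ 𝓝 (x, t) := prod_mem_nhds (Metric.closedBall_mem_nhds x hr)
    (Icc_mem_nhds (by linarith) (by linarith))
  set h : ℕ → ℝ := meshSize with hh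
  have hpos : ∀ n, 0 < h n := meshSize_pos
  have hlim : Tendsto h 𝓤 (𝓝 0) := tendsto_meshSize
  let U : ℕ → ℕ → 𝔼 → ℝ := fun n => lfIter H k b (h n) u₀
  have hUa : ∀ (n j : ℕ) (y : 𝔼), lfApprox H k b (h n) u₀ (y, j * h n) = U n j y := fun n j y => by
    simp only [lfApprox, U]
    rw [mul_div_cancel_right₀ _ (hpos n).ne', Nat.floor_natCast]
  -- the reference points
  have hfl : Tendsto (fun n => (⌊t / h n⌋₊ : ℝ) * h n) 𝓤 (𝓝 t) := by
    have h1 : Tendsto (fun n => t - h n) 𝓤 (𝓝 t) := by simpa using hlim.const_sub t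
    refine tendsto_of_tendsto_of_tendsto_of_le_of_le h1 tendsto_const_nhds (fun n => ?_) fun n => ?_
    · have := (Nat.lt_floor_add_one (t / h n)).le
      rw [div_le_iff₀ (hpos n)] at this
      simp only
      linarith
    · simp only
      rw [← le_div_iff₀ (hpos n)]
      exact Nat.floor_le (div_nonneg ht.le (hpos n).le)
  have hs₀ : Tendsto (fun n => (x, (⌊t / h n⌋₊ : ℝ) * h n)) 𝓤 (𝓝 (x, t)) :=
    tendsto_const_nhds.prodMk_nhds hfl
  have hs₀K : ∀ᶠ n in 𝓤, (x, (⌊t / h n⌋₊ : ℝ) * h n) ∈ K := hs₀ hKn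
  -- maxima on the grid
  have hex : ∀ᶠ n in 𝓤, ∃ z : 𝔼 × ℕ, (z.1, (z.2 : ℝ) * h n) ∈ K ∧
      ∀ w : 𝔼 × ℕ, (w.1, (w.2 : ℝ) * h n) ∈ K →
        U n w.2 w.1 - φ (w.1, w.2 * h n) ≤ U n z.2 z.1 - φ (z.1, z.2 * h n) := by
    filter_upwards [hs₀K] with n hn
    have hfin : {j : ℕ | (j : ℝ) * h n ∈ Icc (t - r) (t + r)}.Finite := by
      refine (finite_Iic ⌊(t + r) / h n⌋₊).subset fun j hj => ?_
      refine Nat.le_floor ?_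
      rw [le_div_iff₀ (hpos n)]
      exact hj.2
    have hcomp : IsCompact (Metric.closedBall x r ×ˢ
        {j : ℕ | (j : ℝ) * h n ∈ Icc (t - r) (t + r)}) :=
      (isCompact_closedBall x r).prod hfin.isCompact
    have hcont : Continuous fun z : 𝔼 × ℕ => U n z.2 z.1 - φ (z.1, z.2 * h n) := by
      rw [continuous_prod_of_discrete_right]
      intro j
      have h1 : Continuous (U n j) := by
        refine (LipschitzWith.of_le_add_mul ⟨L, hL⟩ fun y z => ?_).continuous
        rw [dist_eq_norm]
        exact lfIter_lipschitz hk hH hu₀ (hpos n) j y z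
      have h2 := hφ.continuous
      change Continuous fun y => U n j y - φ (y, j * h n)
      fun_prop
    obtain ⟨z, hz, hzm⟩ := hcomp.exists_isMaxOn ⟨(x, ⌊t / h n⌋₊), hn⟩ hcont.continuousOn
    exact ⟨z, hz, fun w hw => hzm hw⟩
  obtain ⟨z, hz⟩ := hex.choice
  set s : ℕ → 𝔼 × ℝ := fun n => ((z n).1, ((z n).2 : ℝ) * h n) with hs
  have hsK : ∀ᶠ n in 𝓤, s n ∈ K := hz.mono fun n hn => hn.1
  have hst : Tendsto s 𝓤 (𝓝 (x, t)) := by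
    refine tendsto_of_le_of_strict_max (l := hyperfilter ℕ) hK
      (f := fun n q => lfApprox H k b (h n) u₀ q - φ q) (f₀ := fun q => u q - φ q)
      (fun q hq s hs hsq => ?_) hq₀ hstrict hsK hs₀K hs₀ ?_
    · exact (tendsto_lfApprox hk hH hb hL hu₀ hu (hKT q hq) (hs.mono fun n hn => hKT _ hn)
        hsq).sub ((hφ.continuous.tendsto q).comp hsq)
    · filter_upwards [hz, hs₀K] with n hn hn'
      have := hn.2 (x, ⌊t / h n⌋₊) hn'
      simp only [hs, hUa]
      exact this
  -- the previous time step
  let j : ℕ → ℕ := fun n => (z n).2 - 1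
  have hx : Tendsto (fun n => (z n).1) 𝓤 (𝓝 x) := (continuous_fst.tendsto (x, t)).comp hst
  have htn : Tendsto (fun n => ((z n).2 : ℝ) * h n) 𝓤 (𝓝 t) :=
    (continuous_snd.tendsto (x, t)).comp hst
  -- The grid times tend to `t > 0`, so the index is eventually nonzero and the subtraction in `j`
  -- is not truncated.
  have hj : ∀ᶠ n in 𝓤, (z n).2 = j n + 1 := by
    filter_upwards [htn.eventually (lt_mem_nhds ht)] with n hn
    have : (z n).2 ≠ 0 := fun h0 => by simp [h0] at hn
    simp only [j]
    lia
  have hjt : Tendsto (fun n => (j n : ℝ) * h n) 𝓤 (𝓝 t) := by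
    have h1 : Tendsto (fun n => ((z n).2 : ℝ) * h n - h n) 𝓤 (𝓝 t) := by
      simpa using htn.sub hlim
    refine h1.congr' ?_
    filter_upwards [hj] with n hn
    rw [hn]
    push_cast
    ring
  let ρ : ℕ → ℝ := fun n => h n * lfRatio d k b (j n * h n)
  have hρpos : ∀ n, 0 < ρ n := fun n => mul_pos (hpos n) (lfRatio_pos hk _)
  have hratio : Tendsto (fun n => lfRatio d k b (j n * h n)) 𝓤 (𝓝 (lfRatio d k b t)) :=
    ((continuous_lfRatio hb).tendsto t).comp hjt
  have hρ : Tendsto ρ 𝓤 (𝓝 0) := by simpa using hlim.mul hratio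
  have hbase : Tendsto (fun n => ((z n).1, (j n : ℝ) * h n)) 𝓤 (𝓝 (x, t)) := hx.prodMk_nhds hjt
  have hplus : ∀ i, Tendsto (fun n => ((z n).1 + ρ n • stdVec i, (j n : ℝ) * h n)) 𝓤
      (𝓝 (x, t)) := fun i => by
    refine Tendsto.prodMk_nhds ?_ hjt
    simpa using hx.add (hρ.smul_const (stdVec i : 𝔼))
  have hminus : ∀ i, Tendsto (fun n => ((z n).1 - ρ n • stdVec i, (j n : ℝ) * h n)) 𝓤
      (𝓝 (x, t)) := fun i => by
    refine Tendsto.prodMk_nhds ?_ hjt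
    simpa using hx.sub (hρ.smul_const (stdVec i : 𝔼))
  -- the discrete inequality
  have hineq : ∀ᶠ n in 𝓤, (φ ((z n).1, (z n).2 * h n) - φ ((z n).1, j n * h n)) / h n
      ≤ lfCoeff d * ∑ i, ((φ ((z n).1 + ρ n • stdVec i, j n * h n) - φ ((z n).1, j n * h n)) / h n
          + (φ ((z n).1 - ρ n • stdVec i, j n * h n) - φ ((z n).1, j n * h n)) / h n)
        + inner ℝ (H (centralGradient (ρ n) (fun y => φ (y, j n * h n)) (z n).1))
            (b (j n * h n)) := by
    filter_upwards [hz, hj, hbase hKn, eventually_all.2 fun i => hplus i hKn,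
      eventually_all.2 fun i => hminus i hKn] with n hn hjn h0 h1 h2
    set a : ℝ := U n (z n).2 (z n).1 - φ ((z n).1, (z n).2 * h n) with ha
    -- The stencil lies in `K`, where `φ + a` dominates the scheme and touches it at the grid
    -- maximum; monotonicity transfers one step of the scheme to `φ`.
    have hle : ∀ y : 𝔼, (y, (j n : ℝ) * h n) ∈ K → U n (j n) y ≤ φ (y, j n * h n) + a :=
      fun y hy => by have := hn.2 (y, j n) hy; linarith
    have hstep := lfStep_le_lfStep_add (U := U n (j n)) (V := fun y => φ (y, j n * h n)) (a := a)
      (x := (z n).1) (by positivity)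
      (abs_inner_sub_inner_le hH (b (j n * h n))) (hpos n) (hρpos n)
      (lfRatio_cfl k b _ (hpos n)) (hle _ h0) (fun i => hle _ (h1 i)) (fun i => hle _ (h2 i))
    have hUs : U n (z n).2 (z n).1 = lfStep (fun p => inner ℝ (H p) (b (j n * h n))) (h n) (ρ n)
        (U n (j n)) (z n).1 := by
      rw [hjn]
      rfl
    rw [← hUs] at hstep
    have e1 : U n (z n).2 (z n).1 = φ ((z n).1, (z n).2 * h n) + a := by rw [ha]; ring
    rw [e1, lfStep] at hstep
    have hsum : ∑ i, ((φ ((z n).1 + ρ n • stdVec i, j n * h n) - φ ((z n).1, j n * h n)) / h n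
          + (φ ((z n).1 - ρ n • stdVec i, j n * h n) - φ ((z n).1, j n * h n)) / h n)
        = (∑ i, (φ ((z n).1 + ρ n • stdVec i, j n * h n) + φ ((z n).1 - ρ n • stdVec i, j n * h n)
          - 2 * φ ((z n).1, j n * h n))) / h n := by
      rw [Finset.sum_div]
      exact Finset.sum_congr rfl fun i _ => by ring
    rw [hsum, div_le_iff₀ (hpos n), add_mul, mul_assoc, div_mul_cancel₀ _ (hpos n).ne']
    linarith
  -- passage to the limit
  have hφs : HasStrictFDerivAt φ (spaceTimeForm p τ) (x, t) := by
    have := hφ.contDiffAt.hasStrictFDerivAt (x := (x, t)) (by norm_num)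
    rwa [hd.fderiv] at this
  have hh0 : ∀ᶠ n in 𝓤, h n ≠ 0 := Eventually.of_forall fun n => (hpos n).ne'
  have l1 : Tendsto (fun n => (φ ((z n).1, (z n).2 * h n) - φ ((z n).1, j n * h n)) / h n) 𝓤
      (𝓝 τ) := by
    have := hφs.tendsto_div hst hbase (w := fun _ => ((0 : 𝔼), (1 : ℝ))) tendsto_const_nhds
      (h := h) (by
        filter_upwards [hj] with n hn
        simp only [hs, hn]
        ext <;> simp
        ring) hh0
    simpa using this
  have l2 : ∀ i, Tendsto (fun n =>
      (φ ((z n).1 + ρ n • stdVec i, j n * h n) - φ ((z n).1, j n * h n)) / h n) 𝓤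
      (𝓝 (spaceTimeForm p τ (lfRatio d k b t • stdVec i, 0))) := fun i => by
    refine hφs.tendsto_div (hplus i) hbase
      (w := fun n => (lfRatio d k b (j n * h n) • (stdVec i : 𝔼), (0 : ℝ)))
      ((hratio.smul_const _).prodMk_nhds tendsto_const_nhds) (h := h)
      (Eventually.of_forall fun n => ?_) hh0
    simp only [Prod.mk_sub_mk, add_sub_cancel_left, sub_self, Prod.smul_mk, smul_zero, ρ, smul_smul]
  have l3 : ∀ i, Tendsto (fun n =>
      (φ ((z n).1 - ρ n • stdVec i, j n * h n) - φ ((z n).1, j n * h n)) / h n) 𝓤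
      (𝓝 (spaceTimeForm p τ (-(lfRatio d k b t • stdVec i), 0))) := fun i => by
    refine hφs.tendsto_div (hminus i) hbase
      (w := fun n => (-(lfRatio d k b (j n * h n) • (stdVec i : 𝔼)), (0 : ℝ)))
      ((hratio.smul_const _).neg.prodMk_nhds tendsto_const_nhds) (h := h)
      (Eventually.of_forall fun n => ?_) hh0
    simp only [Prod.mk_sub_mk, sub_sub_cancel_left, sub_self, Prod.smul_mk, smul_zero, ρ, smul_smul,
      smul_neg]
  have l4 : Tendsto (fun n => centralGradient (ρ n) (fun y => φ (y, j n * h n)) (z n).1) 𝓤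
      (𝓝 p) := by
    have e1 : Tendsto (fun n => WithLp.ofLp
        (centralGradient (ρ n) (fun y => φ (y, j n * h n)) (z n).1)) 𝓤 (𝓝 (WithLp.ofLp p)) := by
      rw [tendsto_pi_nhds]
      intro i
      have := hφs.tendsto_div (hplus i) (hminus i) (w := fun _ => ((stdVec i : 𝔼), (0 : ℝ)))
        tendsto_const_nhds (h := fun n => 2 * ρ n) (Eventually.of_forall fun n => by
          ext1
          · simp only [Prod.fst_sub, Prod.smul_mk]
            module
          · simp) (Eventually.of_forall fun n => by have := hρpos n; positivity)
      simpa [centralGradient, stdVec, EuclideanSpace.inner_single_right] using this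
    exact ((PiLp.continuous_toLp 2 _).tendsto _).comp e1
  -- The numerical viscosity vanishes because the quotients in opposite directions have opposite
  -- limits; C¹ regularity of `φ` suffices.
  have l5 : Tendsto (fun n => lfCoeff d * ∑ i,
      ((φ ((z n).1 + ρ n • stdVec i, j n * h n) - φ ((z n).1, j n * h n)) / h n
          + (φ ((z n).1 - ρ n • stdVec i, j n * h n) - φ ((z n).1, j n * h n)) / h n)) 𝓤
      (𝓝 0) := by
    have := (tendsto_finsetSum Finset.univ fun i _ => (l2 i).add (l3 i)).const_mul (lfCoeff d)
    simpa using this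
  have l6 := l5.add (((hHc.tendsto p).comp l4).inner ((hb.tendsto t).comp hjt))
  rw [zero_add] at l6
  exact le_of_tendsto_of_tendsto l1 l6 hineq

/-- Existence of Lipschitz viscosity solutions for Lipschitz Hamiltonians and initial data. -/
theorem exists_isViscositySolution_of_lipschitz (hk : 0 ≤ k)
    (hH : ∀ p q, ‖H p - H q‖ ≤ k * ‖p - q‖) {B : ℝ → 𝔽} (hB : IsC1Path B) (hL : 0 ≤ L)
    (hu₀ : ∀ x y, u₀ x ≤ u₀ y + L * ‖x - y‖) {C : ℝ} (hC : ∀ x, |u₀ x| ≤ C) :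
    ∃ u, IsViscositySolution H B u₀ u ∧
      ∀ x y t, 0 ≤ t → |u (x, t) - u (y, t)| ≤ L * ‖x - y‖ := by
  obtain ⟨b, hb, hdb⟩ := hB.exists_deriv
  have hHc : Continuous H := by
    refine (LipschitzWith.of_dist_le_mul (K := ⟨k, hk⟩) fun p q => ?_).continuous
    rw [dist_eq_norm, dist_eq_norm]
    exact hH p q
  obtain ⟨u, hu⟩ := exists_lfLimit hk hH hb hL hu₀
  have hinit : ∀ x, u (x, 0) = u₀ x := fun x => by
    have h0 : ∀ n, lfApprox H k b (meshSize n) u₀ (x, 0) = u₀ x := fun n => by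
      simp [lfApprox, lfIter]
    have := hu (x, 0)
    simp only [h0] at this
    exact tendsto_nhds_unique this tendsto_const_nhds |>.symm ▸ rfl
  have hmod := exists_abs_lfLimit_sub_le hk hH hb hL hu₀ hu
  refine ⟨u, ⟨fun T hT => ?_, hinit, isViscositySubsolution_lfLimit hk hH hHc hb hL hu₀ hu hdb,
    IsViscositySupersolution.of_neg ?_⟩, fun x y t ht => ?_⟩
  · obtain ⟨Γ, hΓ0, hΓ⟩ := hmod T
    refine ⟨⟨C + Γ * T, ?_⟩, ?_⟩
    · rintro ⟨x, t⟩ ⟨-, ht⟩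
      have h1 := hΓ x x t ht 0 ⟨le_rfl, hT.le⟩
      rw [sub_self, norm_zero, mul_zero, zero_add, sub_zero, hinit, abs_of_nonneg ht.1] at h1
      have h2 := abs_sub_abs_le_abs_sub (u (x, t)) (u₀ x)
      have h3 := hC x
      have h4 : Γ * t ≤ Γ * T := by gcongr; exact ht.2
      linarith
    · refine (LipschitzOnWith.of_dist_le_mul (K := ⟨L + Γ, by positivity⟩) ?_).uniformContinuousOn
      rintro ⟨x, t⟩ ⟨-, ht⟩ ⟨y, s⟩ ⟨-, hs⟩
      have h1 := hΓ x y t ht s hs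
      rw [Real.dist_eq, Prod.dist_eq, dist_eq_norm, Real.dist_eq]
      refine h1.trans ?_
      change _ ≤ (L + Γ) * max ‖x - y‖ |t - s|
      rw [add_mul]
      gcongr
      · exact le_max_left _ _
      · exact le_max_right _ _
  -- The scheme commutes with the reflection, so the limit for the reflected Hamiltonian and datum
  -- is `-u` along the same ultrafilter.
  · refine isViscositySubsolution_lfLimit (u₀ := fun y => -u₀ y) (k := k) (L := L) hk
      (fun p q => ?_) (by fun_prop) hb hL (fun x y => ?_) (fun q => ?_) hdb
    · have := hH (-p) (-q)
      rw [neg_sub_neg, ← norm_neg, neg_sub] at this ⊢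
      simpa [norm_sub_rev] using this
    · have := hu₀ y x
      rw [norm_sub_rev] at this
      linarith
    · simp only [lfApprox, lfIter_neg]
      exact (hu q).neg
  · obtain ⟨Γ, hΓ0, hΓ⟩ := hmod t
    simpa using hΓ x y t ⟨ht, le_rfl⟩ t ⟨ht, le_rfl⟩

end SchemeLimit

/-! ### Existence for general data -/

section Existence

variable {d m : ℕ}

local notation "𝔼" => EuclideanSpace ℝ (Fin d)
local notation "𝔽" => EuclideanSpace ℝ (Fin m)

/-- Uniform continuity handles distances below some `η`; beyond it, boundedness allows the slope `2
* |C| / η`. -/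
theorem IsBUCOn.exists_sub_le_add_mul {X : Type*} [PseudoMetricSpace X] {f : X → ℝ}
    (hf : IsBUCOn f univ) {δ : ℝ} (hδ : 0 < δ) :
    ∃ L, 0 ≤ L ∧ ∀ x y, f x - f y ≤ δ + L * dist x y := by
  obtain ⟨⟨C, hC⟩, huc⟩ := hf
  obtain ⟨η, hη, h⟩ := Metric.uniformContinuousOn_iff_le.1 huc δ hδ
  refine ⟨2 * |C| / η, by positivity, fun x y => ?_⟩
  rcases le_total (dist x y) η with hxy | hxy
  · have h1 := (le_abs_self _).trans (h x (mem_univ _) y (mem_univ _) hxy)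
    have h2 : 0 ≤ 2 * |C| / η * dist x y := by positivity
    linarith
  · have h1 := abs_le.1 (hC x (mem_univ _))
    have h2 := abs_le.1 (hC y (mem_univ _))
    have h3 := le_abs_self C
    have h4 : 2 * |C| ≤ 2 * |C| / η * dist x y := by
      calc 2 * |C| = 2 * |C| / η * η := by field_simp
        _ ≤ _ := by gcongr
    linarith

/-- Lipschitz regularization by infimal convolution. -/
theorem exists_lipschitz_approx {f : 𝔼 → ℝ} (hf : IsBUCOn f univ) {δ : ℝ} (hδ : 0 < δ) :
    ∃ (g : 𝔼 → ℝ) (L C : ℝ), 0 ≤ L ∧ (∀ x y, g x ≤ g y + L * ‖x - y‖) ∧ (∀ x, |g x| ≤ C) ∧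
      ∀ x, |g x - f x| ≤ δ := by
  obtain ⟨L, hL, h⟩ := hf.exists_sub_le_add_mul hδ
  obtain ⟨C, hC⟩ := hf.1
  simp only [dist_eq_norm] at h
  have hbdd : ∀ x, BddBelow (range fun y => f y + L * ‖x - y‖) := fun x =>
    ⟨f x - δ, by rintro _ ⟨y, rfl⟩; have := h x y; simp only; linarith⟩
  set g : 𝔼 → ℝ := fun x => ⨅ y, (f y + L * ‖x - y‖) with hg
  have h1 : ∀ x, f x - δ ≤ g x := fun x => le_ciInf fun y => by have := h x y; linarith
  have h2 : ∀ x, g x ≤ f x := fun x => by simpa using ciInf_le (hbdd x) x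
  refine ⟨g, L, C + δ, hL, fun x y => ?_, fun x => ?_, fun x => ?_⟩
  · rw [← sub_le_iff_le_add]
    refine le_ciInf fun z => ?_
    have e1 := ciInf_le (hbdd x) z
    have e2 : L * ‖x - z‖ ≤ L * ‖y - z‖ + L * ‖x - y‖ := by
      rw [← mul_add]
      gcongr
      rw [add_comm]
      exact norm_sub_le_norm_sub_add_norm_sub x y z
    simp only [hg]
    linarith
  · have e1 := abs_le.1 (hC x (mem_univ _))
    exact abs_le.2 ⟨by linarith [h1 x], by linarith [h2 x]⟩
  · exact abs_le.2 ⟨by linarith [h1 x], by linarith [h2 x]⟩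

/-- Test functions touching a Lipschitz function have bounded gradients. -/
theorem norm_le_of_isLocalMax {u φ : 𝔼 × ℝ → ℝ} {L : ℝ} (hL : 0 ≤ L) {x : 𝔼}
    {t : ℝ} (hu : ∀ y, u (x, t) - u (y, t) ≤ L * ‖y - x‖)
    (hmax : IsLocalMax (fun q => u q - φ q) (x, t)) {p : 𝔼} {τ : ℝ}
    (hd : HasFDerivAt φ (spaceTimeForm p τ) (x, t)) : ‖p‖ ≤ L := by
  refine le_of_forall_pos_le_add fun ε hε => ?_
  have h1 := (Asymptotics.isLittleO_iff.1 (hasFDerivAt_iff_isLittleO.1 hd)) hε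
  -- Along this ray `φ` drops by about `s * ‖p‖ ^ 2`, and at the maximum this drop cannot exceed
  -- that of `u`, at most `L * s * ‖p‖`.
  have hc : Tendsto (fun s : ℝ => (x - s • p, t)) (𝓝[>] 0) (𝓝 (x, t)) := by
    have : Continuous (fun s : ℝ => (x - s • p, t)) := by fun_prop
    have h := this.tendsto 0
    simp only [zero_smul, sub_zero] at h
    exact h.mono_left nhdsWithin_le_nhds
  obtain ⟨s, ⟨hs1, hs2⟩, hs⟩ := (((hc.eventually h1).and (hc.eventually hmax)).and
    self_mem_nhdsWithin).exists
  have hs0 : 0 < s := hs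
  simp only [Prod.mk_sub_mk, sub_sub_cancel_left, sub_self, spaceTimeForm_apply, mul_zero,
    add_zero, inner_neg_right, real_inner_smul_right, real_inner_self_eq_norm_sq] at hs1
  have hn : ‖((-(s • p), 0) : 𝔼 × ℝ)‖ = s * ‖p‖ := by
    have : 0 ≤ s * ‖p‖ := by positivity
    simpa [Prod.norm_def, norm_smul, abs_of_pos hs0] using this
  rw [hn, Real.norm_eq_abs] at hs1
  have h2 := (abs_le.1 hs1).2
  have h3 := hu (x - s • p)
  rw [sub_sub_cancel_left, norm_neg, norm_smul, Real.norm_of_nonneg hs0.le] at h3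
  have h4 : s * ‖p‖ * ‖p‖ ≤ s * ‖p‖ * (L + ε) := by nlinarith
  rcases (norm_nonneg p).eq_or_lt with h0 | h0
  · linarith
  · exact le_of_mul_le_mul_left h4 (by positivity)

/-- The values of the Hamiltonian at large gradients are irrelevant for Lipschitz solutions. -/
theorem IsViscositySolution.congr_hamiltonian {H H' : 𝔼 → 𝔽} {B : ℝ → 𝔽} {u₀ : 𝔼 → ℝ}
    {u : 𝔼 × ℝ → ℝ} {L : ℝ} (hu : IsViscositySolution H' B u₀ u) (hL : 0 ≤ L)
    (hLip : ∀ x y t, 0 ≤ t → |u (x, t) - u (y, t)| ≤ L * ‖x - y‖)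
    (hH : ∀ p, ‖p‖ ≤ L → H' p = H p) : IsViscositySolution H B u₀ u := by
  refine ⟨hu.buc, hu.initial, fun φ hφ x t ht hmax => ?_, fun φ hφ x t ht hmin => ?_⟩
  · obtain ⟨p, τ, hd⟩ := hφ.exists_hasFDerivAt_spaceTimeForm (x, t)
    have hp : ‖p‖ ≤ L := norm_le_of_isLocalMax hL (fun y => by
      have := (le_abs_self _).trans (hLip x y t ht.le)
      rwa [norm_sub_rev] at this) hmax hd
    have h := hu.sub.le_of_isLocalMax ht hφ.contDiffAt hmax hd
    rwa [hd.deriv_spaceTime, hd.gradient_spaceTime, drivenHamiltonian_eq_inner, ← hH p hp]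
  · obtain ⟨p, τ, hd⟩ := hφ.exists_hasFDerivAt_spaceTimeForm (x, t)
    have hmax : IsLocalMax (fun q => -u q - -φ q) (x, t) := by
      filter_upwards [hmin] with z hz
      linarith
    have hp : ‖-p‖ ≤ L := norm_le_of_isLocalMax (u := fun q => -u q) hL (fun y => by
      have := (le_abs_self _).trans (hLip y x t ht.le)
      linarith) hmax hd.neg_spaceTimeForm
    rw [norm_neg] at hp
    have h := hu.super.le_of_isLocalMin ht hφ.contDiffAt hmin hd
    rwa [hd.deriv_spaceTime, hd.gradient_spaceTime, drivenHamiltonian_eq_inner, ← hH p hp]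

/-- A function that is `C¹` is Lipschitz on balls; hence it coincides on each ball with a globally
Lipschitz function. -/
theorem exists_lipschitz_eqOn_ball {H : 𝔼 → 𝔽} (hH : ContDiff ℝ 1 H) (L : ℝ) :
    ∃ (H' : 𝔼 → 𝔽) (k : ℝ), 0 ≤ k ∧ (∀ p q, ‖H' p - H' q‖ ≤ k * ‖p - q‖) ∧
      ∀ p, ‖p‖ ≤ L → H' p = H p := by
  obtain ⟨K, hK⟩ := (hH.locallyLipschitz.locallyLipschitzOn
    (s := Metric.closedBall (0 : 𝔼) L)).exists_lipschitzOnWith_of_compact (isCompact_closedBall 0 L)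
  obtain ⟨H', h1, h2⟩ := hK.extend_finite_dimension
  refine ⟨H', (lipschitzExtensionConstant 𝔽 * K : NNReal), NNReal.coe_nonneg _, fun p q => ?_, fun p hp => (h2 (by simpa using hp)).symm⟩
  rw [← dist_eq_norm, ← dist_eq_norm]
  exact h1.dist_le_mul p q

theorem IsBUCSpaceTime.isBUCOn_slice {u : 𝔼 × ℝ → ℝ} (hu : IsBUCSpaceTime u) {t : ℝ}
    (ht : 0 ≤ t) : IsBUCOn (fun x => u (x, t)) univ := by
  obtain ⟨⟨C, hC⟩, h⟩ := hu (t + 1) (by linarith)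
  have hmem : ∀ x : 𝔼, (x, t) ∈ (univ ×ˢ Icc 0 (t + 1) : Set (𝔼 × ℝ)) := fun x =>
    ⟨mem_univ _, ht, by simp⟩
  refine ⟨⟨C, fun x _ => hC _ (hmem x)⟩, h.comp (f := fun x : 𝔼 => (x, t)) ?_ fun x _ => hmem x⟩
  exact (uniformContinuous_id.prodMk uniformContinuous_const).uniformContinuousOn

/-- The comparison principle. -/
theorem IsC11Loc.comparison {H : 𝔼 → 𝔽} (hH : IsC11Loc H) {B : ℝ → 𝔽} (hB : IsC1Path B)
    {u v : 𝔼 × ℝ → ℝ} (hu : IsBUCSpaceTime u) (hv : IsBUCSpaceTime v)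
    (hus : IsViscositySubsolution H B u) (hvs : IsViscositySupersolution H B v) {A : ℝ}
    (hA : ∀ x, u (x, 0) - v (x, 0) ≤ A) (x : 𝔼) {t : ℝ} (ht : 0 ≤ t) :
    u (x, t) - v (x, t) ≤ A := by
  refine le_of_forall_pos_le_add fun ε hε => ?_
  obtain ⟨L, hL, h⟩ := (hu.isBUCOn_slice le_rfl).exists_sub_le_add_mul (half_pos hε)
  -- With a single path the distance is 0, so any positive radius is admissible.
  obtain ⟨r, hr, hest⟩ := hH.exists_stability_radius hL (half_pos hε)
  have := hest (A := A + ε / 2) (T := t + 1) hB hB hu hv hus hvs (fun x y => by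
    have e1 := h x y
    have e2 := hA y
    rw [dist_eq_norm] at e1
    linarith) (fun s _ => by simpa using hr.le) x t ht (by linarith)
  linarith

/-- If two families are asymptotically equal and the second one converges pointwise, then the first
one converges uniformly. -/
theorem tendstoUniformlyOn_of_sub_tendsto {X ι κ : Type*} {l : Filter ι} {l' : Filter κ} [l'.NeBot]
    {f : ι → X → ℝ} {g : κ → X → ℝ} {f₀ : X → ℝ} {S : Set X}
    (h : TendstoUniformlyOn (fun (p : ι × κ) q => f p.1 q - g p.2 q) 0 (l ×ˢ l') S)
    (hg : ∀ q ∈ S, Tendsto (fun n => g n q) l' (𝓝 (f₀ q))) : TendstoUniformlyOn f f₀ l S := by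
  rw [Metric.tendstoUniformlyOn_iff] at h ⊢
  intro ε hε
  filter_upwards [(h (ε / 2) (half_pos hε)).curry] with i hi q hq
  have h1 : ∀ᶠ j in l', |f i q - g j q| ≤ ε / 2 := hi.mono fun j hj => by
    have := hj q hq
    rw [Pi.zero_apply, dist_comm, dist_zero_right] at this
    exact this.le
  have h2 := le_of_tendsto ((tendsto_const_nhds.sub (hg q hq)).abs) h1
  rw [dist_comm, Real.dist_eq]
  linarith

theorem exists_tendsto_of_sub_tendsto {X ι : Type*} {l : Filter ι} [l.NeBot]
    {f : ι → X → ℝ} {S : Set X} (h : ∀ q ∈ S, ∃ S', q ∈ S' ∧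
      TendstoUniformlyOn (fun (p : ι × ι) q => f p.1 q - f p.2 q) 0 (l ×ˢ l) S') :
    ∃ f₀ : X → ℝ, ∀ q ∈ S, Tendsto (fun n => f n q) l (𝓝 (f₀ q)) := by
  have key : ∀ q, ∃ c, q ∈ S → Tendsto (fun n => f n q) l (𝓝 c) := by
    intro q
    by_cases hq : q ∈ S
    · obtain ⟨S', hqS, hS'⟩ := h q hq
      have h1 := hS'.tendsto_at hqS
      have hc : Cauchy (l.map fun n => f n q) := by
        rw [cauchy_map_iff]
        refine ⟨inferInstance, tendsto_uniformity_iff_dist_tendsto_zero.2 ?_⟩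
        simpa [Real.dist_eq] using h1.abs
      obtain ⟨c, hc⟩ := CompleteSpace.complete hc
      exact ⟨c, fun _ => hc⟩
    · exact ⟨0, fun h => absurd h hq⟩
  choose f₀ hf₀ using key
  exact ⟨f₀, hf₀⟩

/-- Existence of viscosity solutions. -/
theorem IsC11Loc.exists_isViscositySolution {H : 𝔼 → 𝔽} (hH : IsC11Loc H) {B : ℝ → 𝔽}
    (hB : IsC1Path B) {u₀ : 𝔼 → ℝ} (hu₀ : IsBUCOn u₀ univ) : ∃ u, IsViscositySolution H B u₀ u := by
  have happrox : ∀ n : ℕ, ∃ (w₀ : 𝔼 → ℝ) (w : 𝔼 × ℝ → ℝ), IsViscositySolution H B w₀ w ∧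
      ∀ x, |w₀ x - u₀ x| ≤ meshSize n := fun n => by
    obtain ⟨g, L, C, hL, h1, h2, h3⟩ := exists_lipschitz_approx hu₀ (meshSize_pos n)
    -- Modifying `H` beyond radius `L` is harmless because the solution stays `L`-Lipschitz in
    -- space.
    obtain ⟨H', k, hk, hH', hHH⟩ := exists_lipschitz_eqOn_ball hH.1 L
    obtain ⟨w, hw, hwL⟩ := exists_isViscositySolution_of_lipschitz hk hH' hB hL h1 h2
    exact ⟨g, w, hw.congr_hamiltonian hL hwL hHH, h3⟩
  choose w₀ w hw hw₀ using happrox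
  have hdiff : ∀ i j x t, 0 ≤ t → w i (x, t) - w j (x, t) ≤ meshSize i + meshSize j :=
    fun i j x t ht => hH.comparison hB (hw i).buc (hw j).buc (hw i).sub (hw j).super (fun y => by
      rw [(hw i).initial, (hw j).initial]
      have e1 := abs_le.1 (hw₀ i y)
      have e2 := abs_le.1 (hw₀ j y)
      linarith) x ht
  have hmesh : Tendsto meshSize atTop (𝓝 0) := tendsto_one_div_add_atTop_nhds_zero_nat
  have hcau : TendstoUniformlyOn (fun (p : ℕ × ℕ) q => w p.1 q - w p.2 q) 0 (atTop ×ˢ atTop)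
      (univ ×ˢ Ici 0) := by
    rw [Metric.tendstoUniformlyOn_iff]
    intro ε hε
    have h1 : ∀ᶠ i in atTop, meshSize i < ε / 2 := hmesh.eventually (gt_mem_nhds (half_pos hε))
    filter_upwards [h1.prod_mk h1] with p hp q hq
    have e1 := hdiff p.1 p.2 q.1 q.2 hq.2
    have e2 := hdiff p.2 p.1 q.1 q.2 hq.2
    rw [Pi.zero_apply, dist_comm, dist_zero_right, Real.norm_eq_abs, abs_lt]
    exact ⟨by linarith [hp.1, hp.2], by linarith [hp.1, hp.2]⟩
  obtain ⟨u, hu⟩ := exists_tendsto_of_sub_tendsto (S := univ ×ˢ Ici 0) fun q hq => ⟨_, hq, hcau⟩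
  have hunif := tendstoUniformlyOn_of_sub_tendsto hcau hu
  have hT : ∀ T, 0 < T → TendstoUniformlyOn w u atTop (univ ×ˢ Icc 0 T) := fun T _ =>
    hunif.mono (prod_mono_right Icc_subset_Ici_self)
  refine ⟨u, isBUCSpaceTime_of_tendsto (Eventually.of_forall fun n => (hw n).buc) hT, fun x => ?_,
    isViscositySubsolution_of_tendsto hH.1.continuous hB (fun n => (hw n).buc)
      (fun n => (hw n).sub) hT,
    isViscositySupersolution_of_tendsto hH.1.continuous hB (fun n => (hw n).buc)
      (fun n => (hw n).super) hT⟩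
  have h1 := hu (x, 0) ⟨mem_univ _, self_mem_Ici⟩
  simp only [(hw _).initial] at h1
  have h2 : Tendsto (fun n => w₀ n x) atTop (𝓝 (u₀ x)) := by
    rw [tendsto_iff_dist_tendsto_zero]
    exact squeeze_zero (fun n => dist_nonneg) (fun n => hw₀ n x) hmesh
  exact tendsto_nhds_unique h1 h2

/-- Families of solutions with asymptotically equal initial data are close as long as their paths
are. -/
theorem IsC11Loc.exists_uniform_stability_radius {H : 𝔼 → 𝔽} (hH : IsC11Loc H) {ι κ : Type*}
    {l : Filter ι} {l' : Filter κ} [l.NeBot] [l'.NeBot] {ζ : ι → ℝ → 𝔽} {ξ : κ → ℝ → 𝔽}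
    {u₀ : ι → 𝔼 → ℝ} {v₀ : κ → 𝔼 → ℝ} {u : ι → 𝔼 × ℝ → ℝ} {v : κ → 𝔼 × ℝ → ℝ}
    (hu : ∀ᶠ i in l, IsC1Path (ζ i) ∧ IsViscositySolution H (ζ i) (u₀ i) (u i))
    (hv : ∀ᶠ j in l', IsC1Path (ξ j) ∧ IsViscositySolution H (ξ j) (v₀ j) (v j))
    (h₀ : TendstoUniformly (fun (p : ι × κ) x => u₀ p.1 x - v₀ p.2 x) 0 (l ×ˢ l'))
    {δ : ℝ} (hδ : 0 < δ) :
    ∃ r > 0, ∀ᶠ p in l ×ˢ l', ∀ T, (∀ t ∈ Icc 0 T, ‖ζ p.1 t - ξ p.2 t‖ ≤ r) →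
      ∀ x t, 0 ≤ t → t < T → |u p.1 (x, t) - v p.2 (x, t)| ≤ δ := by
  set ε : ℝ := δ / 5
  have hε : 0 < ε := by positivity
  have hclose : ∀ᶠ p in l ×ˢ l', ∀ x, |u₀ p.1 x - v₀ p.2 x| ≤ ε := by
    filter_upwards [Metric.tendstoUniformly_iff.1 h₀ ε hε] with p hp x
    have := hp x
    rw [Pi.zero_apply, dist_comm, dist_zero_right] at this
    exact this.le
  obtain ⟨P, hP, Q, hQ, hPQ⟩ := eventually_prod_iff.1 hclose
  -- One fixed datum supplies `L` for both families. Comparison through the indices `i₀` and `j₀`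
  -- costs `4 * ε` and the stability estimate one more `ε`, hence `δ / 5`.
  obtain ⟨i₀, hi₀, hui₀⟩ := (hP.and hu).exists
  obtain ⟨j₀, hj₀⟩ := hQ.exists
  have hbuc : IsBUCOn (u₀ i₀) univ := by
    have := hui₀.2.buc.isBUCOn_slice le_rfl
    simpa only [hui₀.2.initial] using this
  obtain ⟨L, hL, hLu⟩ := hbuc.exists_sub_le_add_mul hε
  simp only [dist_eq_norm] at hLu
  obtain ⟨r, hr, hest⟩ := hH.exists_stability_radius hL hε
  refine ⟨r, hr, ?_⟩
  filter_upwards [(hP.and hu).prod_mk (hQ.and hv)] with p hp T hT x t ht htT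
  obtain ⟨⟨hpP, hζ, hpu⟩, hpQ, hξ, hpv⟩ := hp
  have c1 : ∀ y, |u₀ p.1 y - v₀ j₀ y| ≤ ε := fun y => hPQ hpP hj₀ y
  have c2 : ∀ y, |u₀ i₀ y - v₀ j₀ y| ≤ ε := fun y => hPQ hi₀ hj₀ y
  have c3 : ∀ y, |u₀ i₀ y - v₀ p.2 y| ≤ ε := fun y => hPQ hi₀ hpQ y
  have g1 := hest (A := 4 * ε) hζ hξ hpu.buc hpv.buc hpu.sub hpv.super (fun y z => by
    rw [hpu.initial, hpv.initial]
    have e1 := abs_le.1 (c1 y)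
    have e2 := abs_le.1 (c2 y)
    have e3 := abs_le.1 (c3 z)
    have e4 := hLu y z
    linarith) hT x t ht htT
  have g2 := hest (A := 4 * ε) hξ hζ hpv.buc hpu.buc hpv.sub hpu.super (fun y z => by
    rw [hpu.initial, hpv.initial]
    have e1 := abs_le.1 (c1 z)
    have e2 := abs_le.1 (c2 z)
    have e3 := abs_le.1 (c3 y)
    have e4 := hLu y z
    linarith) (fun s hs => by rw [norm_sub_rev]; exact hT s hs) x t ht htT
  have e5 : 5 * ε = δ := by simp only [ε]; ring
  exact abs_le.2 ⟨by linarith, by linarith⟩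

end Existence

/-! ### Regularization of paths and the extension of the solution operator -/

section RoughPaths

variable {d m : ℕ}

local notation "𝔼" => EuclideanSpace ℝ (Fin d)
local notation "𝔽" => EuclideanSpace ℝ (Fin m)

/-- Continuous paths are locally uniform limits of `C¹` paths. -/
theorem IsContPath.exists_isC1Path_approx {B : ℝ → 𝔽} (hB : IsContPath B) :
    ∃ ζ : ℝ → ℝ → 𝔽, (∀ ε, 0 < ε → IsC1Path (ζ ε)) ∧
      ∀ T, 0 < T → TendstoUniformlyOn ζ B (𝓝[>] 0) (Icc 0 T) := by
  set D : ℝ → 𝔽 := fun t => B (max t 0) with hD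
  have hDc : Continuous D :=
    hB.1.comp_continuous (by fun_prop) fun t => mem_Ici.2 (le_max_right t 0)
  have hDB : ∀ t, 0 ≤ t → D t = B t := fun t ht => by simp [hD, max_eq_left ht]
  set J : ℝ → 𝔽 := fun t => ∫ s in (0 : ℝ)..t, D s with hJ
  have hJd : ∀ t, HasDerivAt J (D t) t := fun t =>
    intervalIntegral.integral_hasDerivAt_right (hDc.intervalIntegrable _ _)
      (hDc.stronglyMeasurableAtFilter _ _) hDc.continuousAt
  have hJc : ContDiff ℝ 1 J := by
    rw [contDiff_one_iff_deriv]
    refine ⟨fun t => (hJd t).differentiableAt, ?_⟩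
    rwa [show deriv J = D from funext fun t => (hJd t).deriv]
  have havg : ∀ ε δ t, 0 < ε → (∀ s ∈ Icc t (t + ε), ‖D s - D t‖ ≤ δ) →
      ‖ε⁻¹ • (J (t + ε) - J t) - D t‖ ≤ δ := by
    intro ε δ t hε hδ
    have e1 : J (t + ε) - J t = ∫ s in t..(t + ε), D s := by
      simp only [hJ]
      exact intervalIntegral.integral_interval_sub_left (hDc.intervalIntegrable _ _)
        (hDc.intervalIntegrable _ _)
    have e2 : J (t + ε) - J t - ε • D t = ∫ s in t..(t + ε), (D s - D t) := by
      rw [intervalIntegral.integral_sub (hDc.intervalIntegrable _ _) (by simp), e1]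
      simp
    have e3 : ‖J (t + ε) - J t - ε • D t‖ ≤ δ * ε := by
      rw [e2]
      have := intervalIntegral.norm_integral_le_of_norm_le_const (a := t) (b := t + ε)
        (f := fun s => D s - D t) (C := δ) fun s hs => by
          rw [uIoc_of_le (by linarith)] at hs
          exact hδ s (Ioc_subset_Icc_self hs)
      simpa [abs_of_pos hε] using this
    have e4 : ε⁻¹ • (J (t + ε) - J t) - D t = ε⁻¹ • (J (t + ε) - J t - ε • D t) := by
      rw [smul_sub ε⁻¹ (J (t + ε) - J t), smul_smul, inv_mul_cancel₀ hε.ne', one_smul]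
    rw [e4, norm_smul, Real.norm_of_nonneg (inv_nonneg.2 hε.le), inv_mul_le_iff₀ hε, mul_comm]
    exact e3
  -- These are forward moving averages of `B`, shifted to start at 0; the shift vanishes in the
  -- limit because `B 0 = 0`.
  refine ⟨fun ε t => ε⁻¹ • (J (t + ε) - J t) - ε⁻¹ • (J (0 + ε) - J 0), fun ε hε =>
    ⟨ContDiff.contDiffOn ?_, by simp⟩, fun T hT => ?_⟩
  · have h1 : ContDiff ℝ 1 fun t => J (t + ε) := hJc.comp (contDiff_id.add contDiff_const)
    exact ((h1.sub hJc).const_smul _).sub contDiff_const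
  · rw [Metric.tendstoUniformlyOn_iff]
    intro ε hε
    obtain ⟨η, hη, hmod⟩ := exists_modulus_on_Icc hDc (T + 1) (ε := ε / 3) (by positivity)
    have hpos : ∀ᶠ e in 𝓝[>] (0 : ℝ), 0 < e := self_mem_nhdsWithin
    have hsmall : ∀ᶠ e in 𝓝[>] (0 : ℝ), e < min η 1 :=
      nhdsWithin_le_nhds (gt_mem_nhds (by positivity))
    filter_upwards [hpos, hsmall] with e he1 he2 t ht
    have he3 := he2.trans_le (min_le_left η 1)
    have he4 := he2.trans_le (min_le_right η 1)
    have key : ∀ t ∈ Icc 0 T, ‖e⁻¹ • (J (t + e) - J t) - D t‖ ≤ ε / 3 := fun t ht => by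
      refine havg e _ t he1 fun s hs => hmod s ⟨ht.1.trans hs.1, ?_⟩ t ⟨ht.1, ?_⟩ ?_
      · linarith [hs.2, ht.2]
      · linarith [ht.2]
      · rw [abs_of_nonneg (sub_nonneg.2 hs.1)]
        linarith [hs.2]
    have k1 := key t ht
    have k2 := key 0 ⟨le_rfl, hT.le⟩
    rw [hDB 0 le_rfl, hB.2, sub_zero] at k2
    rw [hDB t ht.1] at k1
    rw [dist_comm, dist_eq_norm, sub_right_comm]
    exact (norm_sub_le _ _).trans_lt (by linarith)

theorem tendstoUniformlyOn_sub_prod {X V ι κ : Type*} [SeminormedAddCommGroup V] {l : Filter ι}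
    {l' : Filter κ} {f : ι → X → V} {g : κ → X → V} {f₀ : X → V} {S : Set X}
    (hf : TendstoUniformlyOn f f₀ l S) (hg : TendstoUniformlyOn g f₀ l' S) :
    TendstoUniformlyOn (fun (p : ι × κ) x => f p.1 x - g p.2 x) 0 (l ×ˢ l') S := by
  rw [Metric.tendstoUniformlyOn_iff] at *
  intro ε hε
  filter_upwards [(hf (ε / 2) (half_pos hε)).prod_mk (hg (ε / 2) (half_pos hε))] with p hp x hx
  have h1 := hp.1 x hx
  have h2 := hp.2 x hx
  rw [Pi.zero_apply, dist_comm, dist_zero_right, ← dist_eq_norm]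
  exact (dist_triangle_left _ _ (f₀ x)).trans_lt (by linarith)

theorem tendstoUniformlyOn_zero_iff_forall_le {X V ι : Type*} [SeminormedAddCommGroup V]
    {l : Filter ι} {f : ι → X → V} {S : Set X} :
    TendstoUniformlyOn f 0 l S ↔ ∀ δ > 0, ∀ᶠ i in l, ∀ x ∈ S, ‖f i x‖ ≤ δ := by
  rw [Metric.tendstoUniformlyOn_iff]
  constructor
  · intro h δ hδ
    filter_upwards [h δ hδ] with i hi x hx
    have := hi x hx
    rw [Pi.zero_apply, dist_comm, dist_zero_right] at this
    exact this.le
  · intro h δ hδ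
    filter_upwards [h (δ / 2) (half_pos hδ)] with i hi x hx
    have := hi x hx
    rw [Pi.zero_apply, dist_comm, dist_zero_right]
    linarith

theorem IsSolutionFamily.eventually {H : 𝔼 → 𝔽} {ζ : ℝ → ℝ → 𝔽} {u₀ : ℝ → 𝔼 → ℝ}
    {u : ℝ → 𝔼 × ℝ → ℝ} (h : IsSolutionFamily H ζ u₀ u) :
    ∀ᶠ ε in 𝓝[>] 0, IsC1Path (ζ ε) ∧ IsViscositySolution H (ζ ε) (u₀ ε) (u ε) := by
  have hpos : ∀ᶠ e in 𝓝[>] (0 : ℝ), 0 < e := self_mem_nhdsWithin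
  filter_upwards [hpos] with ε hε
  exact ⟨(h ε hε).1, (h ε hε).2.2⟩

section Asymptotics

variable {H : EuclideanSpace ℝ (Fin d) → EuclideanSpace ℝ (Fin m)}
  {ζ ξ : ℝ → ℝ → EuclideanSpace ℝ (Fin m)} {u₀ v₀ : ℝ → EuclideanSpace ℝ (Fin d) → ℝ}
  {u v : ℝ → EuclideanSpace ℝ (Fin d) × ℝ → ℝ}

/-- Asymptotic equality of solutions, locally uniformly in time. -/
theorem IsC11Loc.tendstoUniformlyOn_sub_Icc (hH : IsC11Loc H) (hu : IsSolutionFamily H ζ u₀ u)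
    (hv : IsSolutionFamily H ξ v₀ v)
    (h₀ : TendstoUniformly (fun (p : ℝ × ℝ) x => u₀ p.1 x - v₀ p.2 x) 0 (𝓝[>] 0 ×ˢ 𝓝[>] 0))
    (hpath : ∀ T : ℝ, 0 < T → TendstoUniformlyOn (fun (p : ℝ × ℝ) t => ζ p.1 t - ξ p.2 t) 0
            (𝓝[>] 0 ×ˢ 𝓝[>] 0) (Icc 0 T)) (T : ℝ) (hT : 0 < T) :
    TendstoUniformlyOn (fun (p : ℝ × ℝ) q => u p.1 q - v p.2 q) 0
            (𝓝[>] 0 ×ˢ 𝓝[>] 0) (univ ×ˢ Icc 0 T) := by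
  rw [tendstoUniformlyOn_zero_iff_forall_le]
  intro δ hδ
  obtain ⟨r, hr, h⟩ := hH.exists_uniform_stability_radius hu.eventually hv.eventually h₀ hδ
  filter_upwards [h, tendstoUniformlyOn_zero_iff_forall_le.1 (hpath (T + 1) (by linarith)) r hr]
    with p hp hp' q hq
  exact hp (T + 1) hp' q.1 q.2 hq.2.1 (by linarith [hq.2.2])

/-- Asymptotic equality of solutions, uniformly in time. -/
theorem IsC11Loc.tendstoUniformlyOn_sub_Ici (hH : IsC11Loc H) (hu : IsSolutionFamily H ζ u₀ u)
    (hv : IsSolutionFamily H ξ v₀ v)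
    (h₀ : TendstoUniformly (fun (p : ℝ × ℝ) x => u₀ p.1 x - v₀ p.2 x) 0 (𝓝[>] 0 ×ˢ 𝓝[>] 0))
    (hpath : TendstoUniformlyOn (fun (p : ℝ × ℝ) t => ζ p.1 t - ξ p.2 t) 0
            (𝓝[>] 0 ×ˢ 𝓝[>] 0) (Ici 0)) :
    TendstoUniformlyOn (fun (p : ℝ × ℝ) q => u p.1 q - v p.2 q) 0
            (𝓝[>] 0 ×ˢ 𝓝[>] 0) (univ ×ˢ Ici 0) := by
  rw [tendstoUniformlyOn_zero_iff_forall_le]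
  intro δ hδ
  obtain ⟨r, hr, h⟩ := hH.exists_uniform_stability_radius hu.eventually hv.eventually h₀ hδ
  filter_upwards [h, tendstoUniformlyOn_zero_iff_forall_le.1 hpath r hr] with p hp hp' q hq
  exact hp (q.2 + 1) (fun t ht => hp' t ht.1) q.1 q.2 hq.2 (by linarith)

end Asymptotics

/-- Every continuous path and every initial datum admit an approximating family of solutions that
converges; for `C¹` paths the limit is the viscosity solution. -/
theorem IsC11Loc.exists_convergent_family {H : 𝔼 → 𝔽} (hH : IsC11Loc H) {B : ℝ → 𝔽}
    (hB : IsContPath B) {u₀ : 𝔼 → ℝ} (hu₀ : IsBUCOn u₀ univ) :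
    ∃ (u : 𝔼 × ℝ → ℝ) (ζ : ℝ → ℝ → 𝔽) (w : ℝ → 𝔼 × ℝ → ℝ), IsBUCSpaceTime u ∧
      IsSolutionFamily H ζ (fun _ => u₀) w ∧
      (∀ T, 0 < T → TendstoUniformlyOn ζ B (𝓝[>] 0) (Icc 0 T)) ∧
      (∀ q ∈ (univ ×ˢ Ici 0 : Set (𝔼 × ℝ)), Tendsto (fun ε => w ε q) (𝓝[>] 0) (𝓝 (u q))) ∧
      (IsC1Path B → IsViscositySolution H B u₀ u) := by
  -- A C¹ path takes the constant family, which identifies the limit with the viscosity solution at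
  -- once.
  by_cases hB1 : IsC1Path B
  · obtain ⟨u, hu⟩ := hH.exists_isViscositySolution hB1 hu₀
    refine ⟨u, fun _ => B, fun _ => u, hu.buc, fun _ _ => ⟨hB1, hu₀, hu⟩, fun T _ => ?_,
      fun q _ => tendsto_const_nhds, fun _ => hu⟩
    rw [Metric.tendstoUniformlyOn_iff]
    intro ε hε
    simp [hε]
  · obtain ⟨ζ, hζ, hζB⟩ := hB.exists_isC1Path_approx
    have hex : ∀ ε, ∃ w, 0 < ε → IsViscositySolution H (ζ ε) u₀ w := fun ε => by
      by_cases hε : 0 < ε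
      · obtain ⟨w, hw⟩ := hH.exists_isViscositySolution (hζ ε hε) hu₀
        exact ⟨w, fun _ => hw⟩
      · exact ⟨0, fun h => absurd h hε⟩
    choose w hw using hex
    have hfam : IsSolutionFamily H ζ (fun _ => u₀) w := fun ε hε => ⟨hζ ε hε, hu₀, hw ε hε⟩
    have h₀ : TendstoUniformly (fun (p : ℝ × ℝ) x => (fun _ : ℝ => u₀) p.1 x
        - (fun _ : ℝ => u₀) p.2 x) 0 (𝓝[>] 0 ×ˢ 𝓝[>] 0) := by
      rw [Metric.tendstoUniformly_iff]
      intro ε hε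
      simp [hε]
    have hcau := hH.tendstoUniformlyOn_sub_Icc hfam hfam h₀
      fun T hT => tendstoUniformlyOn_sub_prod (hζB T hT) (hζB T hT)
    obtain ⟨u, hu⟩ := exists_tendsto_of_sub_tendsto (S := univ ×ˢ Ici 0) (f := w) (l := 𝓝[>] 0)
      fun q hq => by
        have hq2 : 0 ≤ q.2 := hq.2
        exact ⟨univ ×ˢ Icc 0 (q.2 + 1), ⟨mem_univ _, hq2, by linarith⟩, hcau _ (by linarith)⟩
    refine ⟨u, ζ, w, isBUCSpaceTime_of_tendsto (l := 𝓝[>] 0) (un := w) ?_ fun T hT =>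
      tendstoUniformlyOn_of_sub_tendsto (hcau T hT) fun q hq => hu q ⟨hq.1, hq.2.1⟩, hfam, hζB, hu,
      fun h => absurd h hB1⟩
    exact hfam.eventually.mono fun ε hε => hε.2.buc

end RoughPaths

theorem mainTheorem1 {d m : ℕ}
    (H : EuclideanSpace ℝ (Fin d) → EuclideanSpace ℝ (Fin m)) (hH : IsC11Loc H) :
    -- the solution operator on `C¹` paths is well defined
    (∀ (B : ℝ → EuclideanSpace ℝ (Fin m)) (u₀ : EuclideanSpace ℝ (Fin d) → ℝ),
      IsC1Path B → IsBUCOn u₀ univ →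
        ∃ u, IsViscositySolution H B u₀ u ∧
          ∀ v, IsViscositySolution H B u₀ v → EqOn v u (univ ×ˢ Ici 0)) ∧
    -- two families of solutions with asymptotically equal data are asymptotically equal
    (∀ (ζ ξ : ℝ → ℝ → EuclideanSpace ℝ (Fin m)) (u₀ v₀ : ℝ → EuclideanSpace ℝ (Fin d) → ℝ)
      (u v : ℝ → EuclideanSpace ℝ (Fin d) × ℝ → ℝ),
      IsSolutionFamily H ζ u₀ u → IsSolutionFamily H ξ v₀ v →
      TendstoUniformly (fun (p : ℝ × ℝ) x => u₀ p.1 x - v₀ p.2 x) 0 (𝓝[>] 0 ×ˢ 𝓝[>] 0) →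
        -- paths converging in `C([0, ∞))`, i.e. uniformly on each `[0, T]`
        ((∀ T : ℝ, 0 < T → TendstoUniformlyOn (fun (p : ℝ × ℝ) t => ζ p.1 t - ξ p.2 t) 0
            (𝓝[>] 0 ×ˢ 𝓝[>] 0) (Icc 0 T)) →
          ∀ T : ℝ, 0 < T → TendstoUniformlyOn (fun (p : ℝ × ℝ) q => u p.1 q - v p.2 q) 0
            (𝓝[>] 0 ×ˢ 𝓝[>] 0) (univ ×ˢ Icc 0 T)) ∧
        -- paths converging uniformly on the whole half-line
        (TendstoUniformlyOn (fun (p : ℝ × ℝ) t => ζ p.1 t - ξ p.2 t) 0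
            (𝓝[>] 0 ×ˢ 𝓝[>] 0) (Ici 0) →
          TendstoUniformlyOn (fun (p : ℝ × ℝ) q => u p.1 q - v p.2 q) 0
            (𝓝[>] 0 ×ˢ 𝓝[>] 0) (univ ×ˢ Ici 0))) ∧
    -- the solution operator extends uniquely to all continuous paths
    (∀ (B : ℝ → EuclideanSpace ℝ (Fin m)) (u₀ : EuclideanSpace ℝ (Fin d) → ℝ),
      IsContPath B → IsBUCOn u₀ univ →
        ∃ u, IsBUCSpaceTime u ∧ IsLimitOfSolutions H B u₀ u ∧
          (∀ v, IsBUCSpaceTime v → IsLimitOfSolutions H B u₀ v → EqOn v u (univ ×ˢ Ici 0)) ∧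
          (IsC1Path B → IsViscositySolution H B u₀ u) ∧
          -- convergence is uniform for all times if the paths converge uniformly for all times
          (∀ (ζ : ℝ → ℝ → EuclideanSpace ℝ (Fin m)) (w₀ : ℝ → EuclideanSpace ℝ (Fin d) → ℝ)
            (w : ℝ → EuclideanSpace ℝ (Fin d) × ℝ → ℝ),
            IsSolutionFamily H ζ w₀ w →
            TendstoUniformlyOn ζ B (𝓝[>] 0) (Ici 0) →
            TendstoUniformly w₀ u₀ (𝓝[>] 0) →
            TendstoUniformlyOn w u (𝓝[>] 0) (univ ×ˢ Ici 0))) := by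
  refine ⟨fun B u₀ hB hu₀ => ?_, fun ζ ξ u₀ v₀ u v hu hv h₀ =>
    ⟨hH.tendstoUniformlyOn_sub_Icc hu hv h₀, hH.tendstoUniformlyOn_sub_Ici hu hv h₀⟩,
    fun B u₀ hB hu₀ => ?_⟩
  · obtain ⟨u, hu⟩ := hH.exists_isViscositySolution hB hu₀
    refine ⟨u, hu, fun v hv q hq => ?_⟩
    have h1 := hH.comparison hB hu.buc hv.buc hu.sub hv.super (A := 0)
      (fun x => by rw [hu.initial, hv.initial, sub_self]) q.1 hq.2
    have h2 := hH.comparison hB hv.buc hu.buc hv.sub hu.super (A := 0)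
      (fun x => by rw [hu.initial, hv.initial, sub_self]) q.1 hq.2
    exact le_antisymm (sub_nonpos.1 h2) (sub_nonpos.1 h1)
  · obtain ⟨u, ζ, w, hubuc, hfam, hζ, hwu, hC1⟩ := hH.exists_convergent_family hB hu₀
    have hconst : TendstoUniformly (fun (_ : ℝ) => u₀) u₀ (𝓝[>] 0) := by
      rw [Metric.tendstoUniformly_iff]
      intro ε hε
      simp [hε]
    have hdiff : ∀ {w₀ w₀' : ℝ → EuclideanSpace ℝ (Fin d) → ℝ}, TendstoUniformly w₀ u₀ (𝓝[>] 0) →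
        TendstoUniformly w₀' u₀ (𝓝[>] 0) →
        TendstoUniformly (fun (p : ℝ × ℝ) x => w₀ p.1 x - w₀' p.2 x) 0 (𝓝[>] 0 ×ˢ 𝓝[>] 0) := by
      intro w₀ w₀' h h'
      rw [← tendstoUniformlyOn_univ] at *
      exact tendstoUniformlyOn_sub_prod h h'
    have hlim : IsLimitOfSolutions H B u₀ u := by
      intro ζ' w₀' w' hfam' hζ' hw₀' T hT
      exact tendstoUniformlyOn_of_sub_tendsto
        (hH.tendstoUniformlyOn_sub_Icc hfam' hfam (hdiff hw₀' hconst)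
          (fun T hT => tendstoUniformlyOn_sub_prod (hζ' T hT) (hζ T hT)) T hT)
        fun q hq => hwu q ⟨hq.1, hq.2.1⟩
    refine ⟨u, hubuc, hlim, fun v _ hv q hq => ?_, hC1, fun ζ' w₀' w' hfam' hζ' hw₀' => ?_⟩
    · have hq2 : 0 ≤ q.2 := hq.2
      have h1 := (hv ζ _ w hfam hζ hconst (q.2 + 1) (by linarith)).tendsto_at
        (x := q) ⟨mem_univ _, hq2, by linarith⟩
      exact tendsto_nhds_unique h1 (hwu q hq)
    -- The family is compared with itself: the paths `ζ` of the reference family are only known to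
    -- converge locally uniformly, while `ζ'` converges on the whole half-line.
    · refine tendstoUniformlyOn_of_sub_tendsto (hH.tendstoUniformlyOn_sub_Ici hfam' hfam'
        (hdiff hw₀' hw₀') (tendstoUniformlyOn_sub_prod hζ' hζ')) fun q hq => ?_
      have hq2 : 0 ≤ q.2 := hq.2
      exact (hlim ζ' w₀' w' hfam' (fun T _ => hζ'.mono Icc_subset_Ici_self) hw₀' (q.2 + 1)
        (by linarith)).tendsto_at ⟨mem_univ _, hq2, by linarith⟩
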